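/- **Setting.** Let $d\ge 1$. For $s\in\{1,2\}$ let $\alpha_s,\beta_s,\gamma_s\in[0,1]$ with $\alpha_s+\beta_s+\gamma_s=1$, let $\theta_1,\theta_2\ge 0$ with $\theta_1+\theta_2=1$, $\pi_1,\pi_2\in(0,1)$ with $\pi_1+\pi_2=1$, and $\tilde\alpha,\tilde\beta\in[0,1]$ with $\tilde\alpha+\tilde\beta=1$. The identity-depolarizing-erasure channels are the quantum channels from a $d$-dimensional to a $(d+1)$-dimensional system $$\mathcal N^{(s)}(\rho)=\begin{pmatrix}\alpha_s\rho+\beta_s I_d/d&0\\0&\gamma_s\end{pmatrix},\qquad s\in\{1,2\}.$$ **Protocols.** A protocol consists of a number $M\ge1$ of messages, a number $T\ge 1$ of time slots, finite-dimensional systems $A,B,Q$, a density operator $\rho$ on $A_1B_1\cdots A_TB_T$ (copies of $A$, held by the transmitter, and of $B$, held by the receiver), quantum channels $\mathcal E^{(w)}_t$ from $A$ to the $d$-dimensional channel input ($w\in[M]$, $t\in[T]$), a quantum instrument $\{\mathcal M^{(1)},\mathcal M^{(2)}\}$ from (channel output)$\,\otimes B$ to $Q$, and a POVM $\{\Xi^{(w)}\}_{w\in[M]}$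 on $\hat S_1\cdots\hat S_TQ_1\cdots Q_T$. For a uniformly distributed message $W$ and independent channel states $S_1,\dots,S_T$ with $\Pr(S_t=s)=\theta_s$, independent of $W$, the channel $\mathcal N^{(S_t)}\circ\mathcal E^{(W)}_t$ is applied to $A_t$ in every slot $t$; the instrument is then applied in every slot to the channel output together with $B_t$, with outcome $\hat S_t\in\{1,2\}$ and remaining system $Q_t$; finally the POVM is applied to $\hat S_1\cdots\hat S_TQ_1\cdots Q_T$ and gives $\hat W$. Let $$P_{\sf c}=\max_{w}\Pr(\hat W\ne w\mid W=w),\qquad P_{\sf d}=\max_{t}\big(\pi_1\Pr(\hat S_t=2\mid S_t=1)+\pi_2\Pr(\hat S_t=1\mid S_t=2)\big).$$ Given a class of protocols, $(R,P_{\sf e})\in\mathbb R^2$ is *achievable* by the class if for every $\epsilon>0$ some protocol of the class has $\frac{\log_2M}{T}\ge R-\epsilon$, $P_{\sf c}\le\epsilon$ and $P_{\sf d}\le P_{\sf e}$. * $\mathfrak R_u^*$ is the set of all pairs achievable by *unentangled* protocols: $\rho=\sum_z\lambda_z\bigotimes_{t=1}^T(\rho_{A_t|z}\otimes\rho_{B_t|z})$,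 a finite convex combination of products of density operators. * $\mathfrak R_{ue}^*$ is the set of all pairs achievable by protocols *with unreliable entangled resource*: $A_t=\bar A_tZ_{A_t}$ and $B_t=\bar B_tZ_{B_t}$, where the classical registers $Z_{A_t}$ and $Z_{B_t}$ both hold the value $Z_t$ of perfect common randomness $(Z_1,\dots,Z_T)$ (of arbitrary joint distribution on a finite set), independent of $\bar A_1\bar B_1\cdots\bar A_T\bar B_T$, and these systems are in the state $(\mathrm{id}\otimes\mathcal N_B)^{\otimes T}(\psi)$ for an arbitrary density operator $\psi$ on them, with $\mathcal N_B(\rho)=\tilde\alpha\rho+\tilde\beta I_b/b$ and $b=\dim\bar B$ arbitrary. **The explicit region.** For $D\ge1$ and parameters $\alpha_s,\beta_s,\gamma_s,\theta_s,\pi_s$ put $\bar\alpha=\theta_1\alpha_1+\theta_2\alpha_2$, $\bar\beta=\theta_1\beta_1+\theta_2\beta_2$, $\ell(x)=x\log_2x$ with $\ell(0)=0$, and $e(p)=\min_{s\in\{1,2\}}\{\pi_s\alpha_sp+\pi_s\beta_s/D\}$. Let $\mathfrak R_1(D,\alpha,\beta,\gamma,\theta,\pi)$ be the convex hull of the set of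 all $(R,P_{\sf e})\in\mathbb R^2$ for which there are $n\in\{1,\dots,D\}$ and $p_1,p_2\in[0,1]$ with $np_1+(D-n)p_2=1$, $$R\le-n\,\ell\big(p_1\bar\alpha+\tfrac{\bar\beta}{D}\big)-(D-n)\,\ell\big(p_2\bar\alpha+\tfrac{\bar\beta}{D}\big)+\ell\big(\bar\alpha+\tfrac{\bar\beta}{D}\big)+(D-1)\,\ell\big(\tfrac{\bar\beta}{D}\big),$$ $$P_{\sf e}\ge n\,e(p_1)+(D-n)\,e(p_2)+\min\{\pi_1\gamma_1,\pi_2\gamma_2\}.$$ **Theorem.** Let $\ddot\alpha_s=\alpha_s\tilde\alpha$ and $\ddot\beta_s=\alpha_s\tilde\beta+\beta_s$ for $s\in\{1,2\}$, and let $\mathfrak R_{sdc}=\mathfrak R_1(d^2,\ddot\alpha,\ddot\beta,\gamma,\theta,\pi)$. Then $$\operatorname{conv}\big(\mathfrak R_{sdc}\cup\mathfrak R_u^*\big)\subseteq\mathfrak R_{ue}^*.$$ -/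

import Mathlib

open scoped Matrix Kronecker ComplexOrder BigOperators

noncomputable section

namespace JCID

/-! ## Quantum states, channels and measurements

A finite-dimensional quantum system is given by a finite type labelling its computational basis;
operators on it are square complex matrices.  The composite of two systems `A`, `B` has basis
`A × B`, and the composite of `T` copies of a system `I` has basis `Fin T → I`. -/

section Quantum

variable {I J K A B : Type} [Fintype I] [DecidableEq I] [Fintype J] [DecidableEq J]
  [Fintype K] [DecidableEq K]

/-- Density operators. -/
def IsDensity (X : Matrix I I ℂ) : Prop := X.PosSemidef ∧ X.trace = 1

/-- `Φ ⊗ id_K`: the map `Φ` applied to the first factor of a composite system. -/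
def onLeft (K : Type) {I J : Type} (Φ : Matrix I I ℂ →ₗ[ℂ] Matrix J J ℂ) :
    Matrix (I × K) (I × K) ℂ →ₗ[ℂ] Matrix (J × K) (J × K) ℂ where
  toFun X := fun p q => Φ (fun i i' => X (i, p.2) (i', q.2)) p.1 q.1
  map_add' X Y := by
    ext p q
    exact congrFun (congrFun (Φ.map_add (fun i i' => X (i, p.2) (i', q.2))
      (fun i i' => Y (i, p.2) (i', q.2))) p.1) q.1
  map_smul' c X := by
    ext p q
    exact congrFun (congrFun (Φ.map_smul c (fun i i' => X (i, p.2) (i', q.2))) p.1) q.1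

/-- `id_K ⊗ Φ`: the map `Φ` applied to the second factor of a composite system. -/
def onRight (K : Type) {I J : Type} (Φ : Matrix I I ℂ →ₗ[ℂ] Matrix J J ℂ) :
    Matrix (K × I) (K × I) ℂ →ₗ[ℂ] Matrix (K × J) (K × J) ℂ where
  toFun X := fun p q => Φ (fun i i' => X (p.1, i) (q.1, i')) p.2 q.2
  map_add' X Y := by
    ext p q
    exact congrFun (congrFun (Φ.map_add (fun i i' => X (p.1, i) (q.1, i'))
      (fun i i' => Y (p.1, i) (q.1, i'))) p.2) q.2
  map_smul' c X := by
    ext p q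
    exact congrFun (congrFun (Φ.map_smul c (fun i i' => X (p.1, i) (q.1, i'))) p.2) q.2

/-- Complete positivity: `Φ ⊗ id_k` preserves positive semidefiniteness for every `k`. -/
def IsCP (Φ : Matrix I I ℂ →ₗ[ℂ] Matrix J J ℂ) : Prop :=
  ∀ (k : ℕ) (X : Matrix (I × Fin k) (I × Fin k) ℂ), X.PosSemidef → (onLeft (Fin k) Φ X).PosSemidef

/-- Quantum channels: completely positive trace-preserving maps. -/
def IsChannel (Φ : Matrix I I ℂ →ₗ[ℂ] Matrix J J ℂ) : Prop :=
  IsCP Φ ∧ ∀ X, (Φ X).trace = X.trace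

/-- Quantum instruments with outcomes in `S`: families of completely positive maps whose sum is
trace preserving. -/
def IsInstrument {S : Type} [Fintype S] (𝓜 : S → Matrix I I ℂ →ₗ[ℂ] Matrix J J ℂ) : Prop :=
  (∀ s, IsCP (𝓜 s)) ∧ ∀ X, (∑ s, 𝓜 s X).trace = X.trace

/-- Positive operator-valued measures with outcomes in `S`. -/
def IsPOVM {S : Type} [Fintype S] (Ξ : S → Matrix I I ℂ) : Prop :=
  (∀ s, (Ξ s).PosSemidef) ∧ ∑ s, Ξ s = 1

/-- The product operator `X 0 ⊗ X 1 ⊗ ⋯ ⊗ X (T - 1)`. -/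
def prodOp {T : ℕ} (X : Fin T → Matrix I I ℂ) : Matrix (Fin T → I) (Fin T → I) ℂ :=
  fun f f' => ∏ t, X t (f t) (f' t)

/-- The map `Φ 0 ⊗ Φ 1 ⊗ ⋯ ⊗ Φ (T - 1)` applied to an operator `X` on `T` systems, by linear
extension from the products of matrix units. -/
def tensorMap {T : ℕ} (Φ : Fin T → Matrix I I ℂ →ₗ[ℂ] Matrix J J ℂ)
    (X : Matrix (Fin T → I) (Fin T → I) ℂ) : Matrix (Fin T → J) (Fin T → J) ℂ :=
  ∑ f : Fin T → I, ∑ f' : Fin T → I,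
    X f f' • prodOp (fun t => Φ t (Matrix.single (f t) (f' t) 1))

/-- The reduced operator (partial trace over all slots but `t`) on slot `t`. -/
def reduced {T : ℕ} (t : Fin T) (X : Matrix (Fin T → I) (Fin T → I) ℂ) : Matrix I I ℂ :=
  fun i i' => ∑ f : Fin T → I, if f t = i then X f (Function.update f t i') else 0

/-- The depolarizing map `ρ ↦ a ρ + b 1 / dim` (extended linearly from density operators). -/
def depolarizing (I : Type) [Fintype I] [DecidableEq I] (a b : ℝ) :
    Matrix I I ℂ →ₗ[ℂ] Matrix I I ℂ where
  toFun X := (a : ℂ) • X + ((b : ℂ) / (Fintype.card I : ℂ) * X.trace) • (1 : Matrix I I ℂ)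
  map_add' X Y := by
    rw [Matrix.trace_add]
    module
  map_smul' c X := by
    simp only [Matrix.trace_smul, smul_eq_mul, RingHom.id_apply]
    module

/-- The identity-depolarizing-erasure map from a `d`-dimensional to a `(d + 1)`-dimensional system,
`ρ ↦ (a ρ + b 1 / d) ⊞ g |0⟩⟨0|` (extended linearly from density operators); the additional basis
vector, labelled by `Unit`, is the erasure flag `|0⟩`. -/
def ideChannel (d : ℕ) (a b g : ℝ) :
    Matrix (Fin d) (Fin d) ℂ →ₗ[ℂ] Matrix (Fin d ⊕ Unit) (Fin d ⊕ Unit) ℂ where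
  toFun X := Matrix.fromBlocks (depolarizing (Fin d) a b X) 0 0 (fun _ _ => (g : ℂ) * X.trace)
  map_add' X Y := by
    ext i j
    rcases i with i | i <;> rcases j with j | j <;>
      simp [Matrix.fromBlocks, Matrix.trace_add, mul_add]
  map_smul' c X := by
    ext i j
    rcases i with i | i <;> rcases j with j | j <;>
      simp [Matrix.fromBlocks, Matrix.trace_smul, mul_left_comm]

end Quantum

/-! ## Protocols -/

/-- A protocol for joint communication and instantaneous detection with `M` messages and `T` time
slots.  Channel inputs have basis `I`, channel outputs have basis `J`; in every slot `A` and `B`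
label the transmitter's and the receiver's share of the initial state, and `Q` the system that is
left after the instantaneous measurement.  The two channel states `1, 2` are labelled `0, 1`. -/
structure Protocol (I J A B Q : Type) [Fintype I] [DecidableEq I] [Fintype J] [DecidableEq J]
    [Fintype A] [DecidableEq A] [Fintype B] [DecidableEq B] [Fintype Q] [DecidableEq Q]
    (M T : ℕ) where
  /-- the initial state of `A₁ B₁ ⋯ A_T B_T` -/
  ρ : Matrix (Fin T → A × B) (Fin T → A × B) ℂ
  ρ_density : IsDensity ρ
  /-- the encoder of slot `t` for message `w` -/
  enc : Fin T → Fin M → Matrix A A ℂ →ₗ[ℂ] Matrix I I ℂ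
  enc_channel : ∀ t w, IsChannel (enc t w)
  /-- the detection instrument, applied to the channel output and `B` in every slot -/
  instr : Fin 2 → Matrix (J × B) (J × B) ℂ →ₗ[ℂ] Matrix Q Q ℂ
  instr_instrument : IsInstrument instr
  /-- the decoder, applied to all detection results and all remaining systems -/
  dec : Fin M → Matrix ((Fin T → Fin 2) × (Fin T → Q)) ((Fin T → Fin 2) × (Fin T → Q)) ℂ
  dec_povm : IsPOVM dec

namespace Protocol

variable {I J A B Q : Type} [Fintype I] [DecidableEq I] [Fintype J] [DecidableEq J]
  [Fintype A] [DecidableEq A] [Fintype B] [DecidableEq B] [Fintype Q] [DecidableEq Q]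
  {M T : ℕ} (P : Protocol I J A B Q M T)
  (N : Fin 2 → Matrix I I ℂ →ₗ[ℂ] Matrix J J ℂ) (θ π : Fin 2 → ℝ)

/-- The encoded state of `A'₁ B₁ ⋯ A'_T B_T` for message `w`. -/
def encoded (w : Fin M) : Matrix (Fin T → I × B) (Fin T → I × B) ℂ :=
  tensorMap (fun t => onLeft B (P.enc t w)) P.ρ

/-- The state of `A''₁ B₁ ⋯ A''_T B_T` for message `w` and channel state sequence `s`. -/
def received (w : Fin M) (s : Fin T → Fin 2) : Matrix (Fin T → J × B) (Fin T → J × B) ℂ :=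
  tensorMap (fun t => onLeft B (N (s t))) (P.encoded w)

/-- The state of `A''₁ B₁ ⋯ A''_T B_T` for message `w`, averaged over i.i.d. channel states with
distribution `θ`. -/
def receivedAvg (w : Fin M) : Matrix (Fin T → J × B) (Fin T → J × B) ℂ :=
  ∑ s : Fin T → Fin 2, ((∏ t, θ (s t) : ℝ) : ℂ) • P.received N w s

/-- The state of `Ŝ₁ ⋯ Ŝ_T Q₁ ⋯ Q_T` for message `w`, with the classical results `Ŝ` in a
block-diagonal register. -/
def measured (w : Fin M) :
    Matrix ((Fin T → Fin 2) × (Fin T → Q)) ((Fin T → Fin 2) × (Fin T → Q)) ℂ :=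
  ∑ r : Fin T → Fin 2,
    Matrix.single r r (1 : ℂ) ⊗ₖ tensorMap (fun t => P.instr (r t)) (P.receivedAvg N θ w)

/-- `Pr (Ŵ = v | W = w)`. -/
def decodeProb (w v : Fin M) : ℝ := (P.dec v * P.measured N θ w).trace.re

/-- The communication error `P_c = max_w Pr (Ŵ ≠ w | W = w)`. -/
def commError : ℝ := ⨆ w : Fin M, ∑ v ∈ Finset.univ.erase w, P.decodeProb N θ w v

/-- The state of `A''₁ B₁ ⋯ A''_T B_T` conditioned on `S_t = s`, for a uniformly distributed message
and independent channel states with distribution `θ` in the other slots. -/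
def receivedGiven (t : Fin T) (s : Fin 2) : Matrix (Fin T → J × B) (Fin T → J × B) ℂ :=
  ∑ w : Fin M, ∑ r : Fin T → Fin 2,
    if r t = s then
      (((1 / M : ℝ) * ∏ t' ∈ Finset.univ.erase t, θ (r t') : ℝ) : ℂ) • P.received N w r
    else 0

/-- `Pr (Ŝ_t = ŝ | S_t = s)`. -/
def detectProb (t : Fin T) (s ŝ : Fin 2) : ℝ :=
  (P.instr ŝ (reduced t (P.receivedGiven N θ t s))).trace.re

/-- The detection error `P_d = max_t (π₁ Pr (Ŝ_t = 2 | S_t = 1) + π₂ Pr (Ŝ_t = 1 | S_t = 2))`. -/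
def detectError : ℝ :=
  ⨆ t : Fin T, (π 0 * P.detectProb N θ t 0 1 + π 1 * P.detectProb N θ t 1 0)

/-- The requirements on a protocol in the definition of achievability of `(R, Pe)`, for a given
tolerance `ε`. -/
def Meets (R Pe ε : ℝ) : Prop :=
  R - ε ≤ Real.logb 2 M / T ∧ P.commError N θ ≤ ε ∧ P.detectError N θ π ≤ Pe

end Protocol

/-! ## Initial states -/

section InitialStates

variable {A B : Type} [Fintype A] [DecidableEq A] [Fintype B] [DecidableEq B] {T : ℕ}

/-- Initial states of unentangled protocols: separable in time and in space. -/
def IsSeparable (ρ : Matrix (Fin T → A × B) (Fin T → A × B) ℂ) : Prop :=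
  ∃ (m : ℕ) (c : Fin m → ℝ) (ρA : Fin m → Fin T → Matrix A A ℂ) (ρB : Fin m → Fin T → Matrix B B ℂ),
    (∀ z, 0 ≤ c z) ∧ ∑ z, c z = 1 ∧ (∀ z t, IsDensity (ρA z t)) ∧ (∀ z t, IsDensity (ρB z t)) ∧
    ρ = ∑ z, (c z : ℂ) • prodOp (fun t => ρA z t ⊗ₖ ρB z t)

/-- The state in which the transmitter and the receiver share `φ` on the quantum systems `A_t B_t`
and, independently of it, classical common randomness `z = (z₁, …, z_T)` with distribution `p`: in
slot `t` both hold a copy of `z_t` in a classical register (labelled by `Z`). -/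
def withCommonRandomness {Z : Type} [Fintype Z] [DecidableEq Z] (p : (Fin T → Z) → ℝ)
    (φ : Matrix (Fin T → A × B) (Fin T → A × B) ℂ) :
    Matrix (Fin T → (A × Z) × (B × Z)) (Fin T → (A × Z) × (B × Z)) ℂ :=
  fun f f' => ∑ z : Fin T → Z, (p z : ℂ) *
    (φ (fun t => ((f t).1.1, (f t).2.1)) (fun t => ((f' t).1.1, (f' t).2.1)) *
      ∏ t, (Matrix.single (z t) (z t) (1 : ℂ) (f t).1.2 (f' t).1.2 *
        Matrix.single (z t) (z t) (1 : ℂ) (f t).2.2 (f' t).2.2))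

/-- Initial states with an unreliable entangled resource: perfect common randomness together with a
shared, arbitrarily entangled, state `ψ` of `A₁ B₁ ⋯ A_T B_T`, of which every system `B_t` has passed
through the depolarizing channel with parameters `a`, `b`. -/
def IsUnreliable {Z : Type} [Fintype Z] [DecidableEq Z] (a b : ℝ)
    (ρ : Matrix (Fin T → (A × Z) × (B × Z)) (Fin T → (A × Z) × (B × Z)) ℂ) : Prop :=
  ∃ (p : (Fin T → Z) → ℝ) (ψ : Matrix (Fin T → A × B) (Fin T → A × B) ℂ),
    (∀ z, 0 ≤ p z) ∧ ∑ z, p z = 1 ∧ IsDensity ψ ∧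
    ρ = withCommonRandomness p (tensorMap (fun _ => onRight A (depolarizing B a b)) ψ)

end InitialStates

/-! ## Achievable regions -/

section Regions

variable {I J : Type} [Fintype I] [DecidableEq I] [Fintype J] [DecidableEq J]

/-- The pairs `(R, Pe)` achievable by unentangled protocols. -/
def unentangledRegion (N : Fin 2 → Matrix I I ℂ →ₗ[ℂ] Matrix J J ℂ) (θ π : Fin 2 → ℝ) :
    Set (ℝ × ℝ) :=
  {x | ∀ ε : ℝ, 0 < ε →
    ∃ (A B Q : Type) (_ : Fintype A) (_ : DecidableEq A) (_ : Fintype B) (_ : DecidableEq B)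
      (_ : Fintype Q) (_ : DecidableEq Q) (M T : ℕ) (P : Protocol I J A B Q M T),
      0 < M ∧ 0 < T ∧ IsSeparable P.ρ ∧ P.Meets N θ π x.1 x.2 ε}

/-- The pairs `(R, Pe)` achievable with an unreliable entangled resource, where the receiver's share
passes through depolarizing channels with parameters `a`, `b`. -/
def unreliableRegion (N : Fin 2 → Matrix I I ℂ →ₗ[ℂ] Matrix J J ℂ) (θ π : Fin 2 → ℝ) (a b : ℝ) :
    Set (ℝ × ℝ) :=
  {x | ∀ ε : ℝ, 0 < ε →
    ∃ (A B Z Q : Type) (_ : Fintype A) (_ : DecidableEq A) (_ : Fintype B) (_ : DecidableEq B)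
      (_ : Fintype Z) (_ : DecidableEq Z) (_ : Fintype Q) (_ : DecidableEq Q)
      (M T : ℕ) (P : Protocol I J (A × Z) (B × Z) Q M T),
      0 < M ∧ 0 < T ∧ IsUnreliable a b P.ρ ∧ P.Meets N θ π x.1 x.2 ε}

/-- `x log₂ x`, which is `0` at `x = 0`. -/
def xlog (x : ℝ) : ℝ := x * Real.logb 2 x

/-- The explicit region `ℜ₁(D, α, β, γ, θ, π)`. -/
def regionOne (D : ℕ) (α β γ θ π : Fin 2 → ℝ) : Set (ℝ × ℝ) :=
  let α' : ℝ := θ 0 * α 0 + θ 1 * α 1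
  let β' : ℝ := θ 0 * β 0 + θ 1 * β 1
  let e : ℝ → Fin 2 → ℝ := fun p s => π s * α s * p + π s * β s / D
  convexHull ℝ {x : ℝ × ℝ | ∃ (n : ℕ) (p₁ p₂ : ℝ), 1 ≤ n ∧ n ≤ D ∧
    p₁ ∈ Set.Icc (0 : ℝ) 1 ∧ p₂ ∈ Set.Icc (0 : ℝ) 1 ∧ n * p₁ + ((D : ℝ) - n) * p₂ = 1 ∧
    x.1 ≤ -(n * xlog (p₁ * α' + β' / D)) - ((D : ℝ) - n) * xlog (p₂ * α' + β' / D)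
        + xlog (α' + β' / D) + ((D : ℝ) - 1) * xlog (β' / D) ∧
    n * min (e p₁ 0) (e p₁ 1) + ((D : ℝ) - n) * min (e p₂ 0) (e p₂ 1)
        + min (π 0 * γ 0) (π 1 * γ 1) ≤ x.2}

end Regions

end JCID

end

/-! Everything passes through `infoRegion`, taken for one fixed state φ shared in every slot: a
maximally entangled pair whose receiver half is depolarized. A `Scheme` is a block of slots read as
a classical channel from an input letter to a measurement outcome; its figures of merit are the
mutual information per slot and the detection error in each slot. Both sets on the left lie in this
region, the region is convex, and it lies in the set on the right.

Convexity (`infoRegion_convex`): the detection error is a maximum over slots, so concatenating two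
schemes in time would give the larger error instead of the average. Common randomness therefore
selects one of the two schemes, brought to equal length by repetition, for the whole block. Both
parties know the selection, so the mutual information and the error of every slot are averaged.

Coding (`infoRegion_subset_unreliableRegion`): the random codebook of Shannon's theorem is never
fixed but is part of the common randomness. Averaged over codebooks, every message has small error,
so the maximum over messages needs no expurgation; and every codeword is distributed like the input
of the scheme, so the detection probabilities are exactly those of the scheme.

Unentangled protocols (`unentangledRegion_subset_infoRegion`): the index of the separable mixture
serves as common randomness, and product states are prepared locally, with the entanglement ignored.
The protocol becomes a scheme whose letters are the messages, and a Fano inequality bounds its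
mutual information from below by nearly log M.

Explicit region (`regionOne_subset_infoRegion`): superdense coding in a single slot. Depolarizing
half of a maximally entangled pair depolarizes the pair, so without erasure the Bell measurement
sees a symmetric channel on d² letters with the combined parameters, while an erasure reveals
nothing about the letter. Two-valued input distributions give the generators of the hull. -/

open scoped Matrix Kronecker ComplexOrder BigOperators

noncomputable section
namespace JCID

set_option linter.unusedSectionVars false

/-! ### Completely positive maps: building blocks and closure properties -/

section Maps

variable {I J K B : Type} [Fintype I] [DecidableEq I] [Fintype J] [DecidableEq J]
  [Fintype K] [DecidableEq K] [Fintype B] [DecidableEq B]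

/-- The linear map `X ↦ X.submatrix f f`. -/
def submatrixMap (f : J → I) : Matrix I I ℂ →ₗ[ℂ] Matrix J J ℂ where
  toFun X := X.submatrix f f
  map_add' _ _ := rfl
  map_smul' _ _ := rfl

/-- The linear map `X ↦ X ⊗ σ`. -/
def appendMap (σ : Matrix K K ℂ) : Matrix I I ℂ →ₗ[ℂ] Matrix (I × K) (I × K) ℂ where
  toFun X := X ⊗ₖ σ
  map_add' X Y := Matrix.add_kronecker X Y σ
  map_smul' c X := Matrix.smul_kronecker c X σ

/-- The linear map `X ↦ V X Vᴴ`. -/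
def conjMap (V : Matrix J I ℂ) : Matrix I I ℂ →ₗ[ℂ] Matrix J J ℂ where
  toFun X := V * X * Vᴴ
  map_add' X Y := by rw [Matrix.mul_add, Matrix.add_mul]
  map_smul' c X := by simp

@[simp] lemma submatrixMap_apply (f : J → I) (X : Matrix I I ℂ) :
    submatrixMap f X = X.submatrix f f := rfl

@[simp] lemma appendMap_apply (σ : Matrix K K ℂ) (X : Matrix I I ℂ) :
    appendMap σ X = X ⊗ₖ σ := rfl

@[simp] lemma conjMap_apply (V : Matrix J I ℂ) (X : Matrix I I ℂ) :
    conjMap V X = V * X * Vᴴ := rfl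

lemma onLeft_apply (Φ : Matrix I I ℂ →ₗ[ℂ] Matrix J J ℂ) (X : Matrix (I × K) (I × K) ℂ)
    (p q : J × K) : onLeft K Φ X p q =
      Φ (X.submatrix (fun i => (i, p.2)) fun i => (i, q.2)) p.1 q.1 := rfl

lemma onRight_apply (Φ : Matrix I I ℂ →ₗ[ℂ] Matrix J J ℂ) (X : Matrix (K × I) (K × I) ℂ)
    (p q : K × J) : onRight K Φ X p q =
      Φ (X.submatrix (fun i => (p.1, i)) fun i => (q.1, i)) p.2 q.2 := rfl

lemma IsCP.posSemidef {Φ : Matrix I I ℂ →ₗ[ℂ] Matrix J J ℂ} (h : IsCP Φ) {X : Matrix I I ℂ}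
    (hX : X.PosSemidef) : (Φ X).PosSemidef := by
  have := (h 1 (X.submatrix Prod.fst Prod.fst) (hX.submatrix _)).submatrix (fun j : J => (j, 0))
  exact this

/-- Complete positivity is stated for the ancillas `Fin k` only; relabelling the basis carries it to
any finite ancilla. -/
lemma IsCP.onLeft_posSemidef {Φ : Matrix I I ℂ →ₗ[ℂ] Matrix J J ℂ} (h : IsCP Φ)
    {X : Matrix (I × K) (I × K) ℂ} (hX : X.PosSemidef) : (onLeft K Φ X).PosSemidef := by
  let e := Fintype.equivFin K
  have := (h _ (X.submatrix (Prod.map id e.symm) (Prod.map id e.symm))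
    (hX.submatrix _)).submatrix (Prod.map (id : J → J) e)
  convert this using 1
  ext p q
  simp [onLeft_apply, Function.comp_def]

lemma IsCP.comp {L : Type} [Fintype L] [DecidableEq L]
    {Ψ : Matrix J J ℂ →ₗ[ℂ] Matrix L L ℂ} {Φ : Matrix I I ℂ →ₗ[ℂ] Matrix J J ℂ}
    (hΨ : IsCP Ψ) (hΦ : IsCP Φ) : IsCP (Ψ ∘ₗ Φ) :=
  fun k X hX => hΨ k _ (hΦ k X hX)

lemma IsCP.zero : IsCP (0 : Matrix I I ℂ →ₗ[ℂ] Matrix J J ℂ) :=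
  fun _ _ _ => Matrix.PosSemidef.zero

lemma IsCP.add {Φ Ψ : Matrix I I ℂ →ₗ[ℂ] Matrix J J ℂ} (hΦ : IsCP Φ) (hΨ : IsCP Ψ) :
    IsCP (Φ + Ψ) :=
  fun k X hX => (hΦ k X hX).add (hΨ k X hX)

lemma IsCP.sum {ι : Type*} (s : Finset ι) {Φ : ι → Matrix I I ℂ →ₗ[ℂ] Matrix J J ℂ}
    (h : ∀ i ∈ s, IsCP (Φ i)) : IsCP (∑ i ∈ s, Φ i) := by
  classical
  induction s using Finset.induction_on with
  | empty => simpa using IsCP.zero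
  | insert a s ha ih =>
    rw [Finset.sum_insert ha]
    exact (h a (by simp)).add (ih fun i hi => h i (by simp [hi]))

lemma IsCP.smul {Φ : Matrix I I ℂ →ₗ[ℂ] Matrix J J ℂ} (hΦ : IsCP Φ) {c : ℝ} (hc : 0 ≤ c) :
    IsCP ((c : ℂ) • Φ) :=
  fun k X hX => (hΦ k X hX).smul (a := (c : ℂ)) (by exact_mod_cast hc)

lemma isCP_submatrixMap (f : J → I) : IsCP (submatrixMap f) :=
  fun _ _ hX => hX.submatrix (Prod.map f id)

/-- With an ancilla present, the result is X ⊗ σ up to a reordering of the factors. -/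
lemma isCP_appendMap {σ : Matrix K K ℂ} (hσ : σ.PosSemidef) :
    IsCP (appendMap σ : Matrix I I ℂ →ₗ[ℂ] _) :=
  fun k _ hX => (hX.kronecker hσ).submatrix
    (fun p : (I × K) × Fin k => ((p.1.1, p.2), p.1.2))

lemma onLeft_conjMap (V : Matrix J I ℂ) (X : Matrix (I × K) (I × K) ℂ) :
    onLeft K (conjMap V) X
      = (V ⊗ₖ (1 : Matrix K K ℂ)) * X * (V ⊗ₖ (1 : Matrix K K ℂ))ᴴ := by
  ext ⟨j, l⟩ ⟨j', l'⟩
  rw [onLeft_apply, conjMap_apply]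
  simp [Matrix.mul_apply, Fintype.sum_prod_type, Matrix.one_apply, apply_ite]

lemma isCP_conjMap (V : Matrix J I ℂ) : IsCP (conjMap V) := by
  intro k X hX
  rw [onLeft_conjMap]
  exact hX.mul_mul_conjTranspose_same _

lemma IsDensity.prod {A : Type} [Fintype A] [DecidableEq A] {σ : Matrix A A ℂ}
    {τ : Matrix B B ℂ} (hσ : IsDensity σ) (hτ : IsDensity τ) : IsDensity (σ ⊗ₖ τ) :=
  ⟨hσ.1.kronecker hτ.1, by rw [Matrix.trace_kronecker, hσ.2, hτ.2, one_mul]⟩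

lemma isDensity_single (i : I) : IsDensity (Matrix.single i i (1 : ℂ)) := by
  refine ⟨?_, by simp⟩
  have := (Matrix.PosSemidef.one (n := I) (R := ℂ)).mul_mul_conjTranspose_same
    (Matrix.single i i (1 : ℂ))
  simpa using this

lemma trace_onLeft {Φ : Matrix I I ℂ →ₗ[ℂ] Matrix J J ℂ} (h : ∀ X, (Φ X).trace = X.trace)
    (X : Matrix (I × K) (I × K) ℂ) : (onLeft K Φ X).trace = X.trace := by
  have : ∀ k, ∑ j, onLeft K Φ X (j, k) (j, k) = ∑ i, X (i, k) (i, k) := fun k =>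
    h (X.submatrix (fun i => (i, k)) fun i => (i, k))
  simp only [Matrix.trace, Matrix.diag_apply, Fintype.sum_prod_type_right, this]

lemma IsChannel.isDensity_onLeft {Φ : Matrix I I ℂ →ₗ[ℂ] Matrix J J ℂ} (h : IsChannel Φ)
    {X : Matrix (I × K) (I × K) ℂ} (hX : IsDensity X) : IsDensity (onLeft K Φ X) :=
  ⟨h.1.onLeft_posSemidef hX.1, by rw [trace_onLeft h.2, hX.2]⟩

open scoped MatrixOrder Matrix.Norms.L2Operator in
lemma exists_eq_conjTranspose_mul_self {X : Matrix I I ℂ} (hX : X.PosSemidef) :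
    ∃ V : Matrix I I ℂ, X = Vᴴ * V :=
  CStarAlgebra.nonneg_iff_eq_star_mul_self.mp hX.nonneg

/-- A product of a positive semidefinite pair has nonnegative trace. -/
lemma trace_mul_re_nonneg {X Y : Matrix I I ℂ} (hX : X.PosSemidef) (hY : Y.PosSemidef) :
    0 ≤ (X * Y).trace.re := by
  obtain ⟨V, rfl⟩ := exists_eq_conjTranspose_mul_self hX
  have h := (hY.mul_mul_conjTranspose_same V).trace_nonneg
  rw [Matrix.trace_mul_comm, ← Matrix.mul_assoc, Matrix.trace_mul_comm, ← Matrix.mul_assoc]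
  exact (Complex.le_def.1 h).1

/-- Probabilities are defined as real parts; knowing that the traces are real makes them
multiplicative over independent blocks. -/
lemma ofReal_trace_mul_re {X Y : Matrix I I ℂ} (hX : X.PosSemidef) (hY : Y.PosSemidef) :
    ((X * Y).trace.re : ℂ) = (X * Y).trace := by
  obtain ⟨V, rfl⟩ := exists_eq_conjTranspose_mul_self hX
  have h := (hY.mul_mul_conjTranspose_same V).trace_nonneg
  rw [Matrix.trace_mul_comm, ← Matrix.mul_assoc, Matrix.trace_mul_comm, ← Matrix.mul_assoc]
  exact Complex.ext rfl (Complex.le_def.1 h).2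

lemma trace_submatrix_equiv (e : J ≃ I) (X : Matrix I I ℂ) :
    (X.submatrix e e).trace = X.trace :=
  e.sum_comp fun i => X i i

end Maps

/-! ### Product operators on several slots -/

section Products

variable {I J K B : Type} [Fintype I] [DecidableEq I] [Fintype J] [DecidableEq J]
  [Fintype K] [DecidableEq K] [Fintype B] [DecidableEq B] {T : ℕ}

lemma linearMap_apply_eq_sum (Φ : Matrix I I ℂ →ₗ[ℂ] Matrix J J ℂ) (X : Matrix I I ℂ) (j j' : J) :
    Φ X j j' = ∑ i, ∑ i', X i i' * Φ (Matrix.single i i' 1) j j' := by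
  conv_lhs => rw [Matrix.matrix_eq_sum_single X]
  simp only [map_sum, Matrix.sum_apply]
  refine Finset.sum_congr rfl fun i _ => Finset.sum_congr rfl fun i' _ => ?_
  have : Matrix.single i i' (X i i') = X i i' • Matrix.single i i' (1 : ℂ) := by simp
  rw [this, map_smul, Matrix.smul_apply, smul_eq_mul]

lemma prod_sum_eq_sum_prod {τ ι R : Type*} [Fintype τ] [DecidableEq τ] [Fintype ι] [CommSemiring R]
    (f : τ → ι → R) : ∏ t, ∑ i, f t i = ∑ g : τ → ι, ∏ t, f t (g t) := by
  rw [Finset.prod_univ_sum, Fintype.piFinset_univ]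

/-- Expanding each factor in matrix units and multiplying out gives the sum that defines
`tensorMap`. All states below are mixtures of product operators, so together with linearity this is
all that is needed of `tensorMap`. -/
lemma tensorMap_prodOp (Φ : Fin T → Matrix I I ℂ →ₗ[ℂ] Matrix J J ℂ)
    (X : Fin T → Matrix I I ℂ) :
    tensorMap Φ (prodOp X) = prodOp fun t => Φ t (X t) := by
  ext f f'
  have h : ∀ t, Φ t (X t) (f t) (f' t)
      = ∑ p : I × I, X t p.1 p.2 * Φ t (Matrix.single p.1 p.2 1) (f t) (f' t) := fun t => by
    rw [linearMap_apply_eq_sum, Fintype.sum_prod_type]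
  simp only [tensorMap, prodOp, h, Matrix.sum_apply, Matrix.smul_apply, smul_eq_mul,
    prod_sum_eq_sum_prod, ← Finset.prod_mul_distrib]
  rw [← (Equiv.arrowProdEquivProdArrow (Fin T) (fun _ => I) (fun _ => I)).symm.sum_comp,
    Fintype.sum_prod_type]
  rfl

lemma tensorMap_sum {ι : Type*} (s : Finset ι) (Φ : Fin T → Matrix I I ℂ →ₗ[ℂ] Matrix J J ℂ)
    (c : ι → ℂ) (X : ι → Matrix (Fin T → I) (Fin T → I) ℂ) :
    tensorMap Φ (∑ i ∈ s, c i • X i) = ∑ i ∈ s, c i • tensorMap Φ (X i) := by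
  have h : ∀ f f', (∑ i ∈ s, c i • X i) f f' = ∑ i ∈ s, c i * X i f f' := fun f f' => by
    simp [Matrix.sum_apply]
  simp only [tensorMap, h, Finset.sum_smul, Finset.smul_sum, mul_smul]
  rw [Finset.sum_comm]
  refine (Finset.sum_congr rfl fun f _ => Finset.sum_comm).trans ?_
  rw [Finset.sum_comm]
  exact Finset.sum_congr rfl fun i _ => Finset.sum_comm

lemma trace_prodOp (X : Fin T → Matrix I I ℂ) : (prodOp X).trace = ∏ t, (X t).trace := by
  simp only [Matrix.trace, Matrix.diag_apply, prodOp, prod_sum_eq_sum_prod]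

/-- If each factor is a Gram matrix of V t, the product is the Gram matrix of the product of the V
t. -/
lemma prodOp_posSemidef {X : Fin T → Matrix I I ℂ} (h : ∀ t, (X t).PosSemidef) :
    (prodOp X).PosSemidef := by
  choose V hV using fun t => exists_eq_conjTranspose_mul_self (h t)
  convert Matrix.posSemidef_conjTranspose_mul_self (prodOp V) using 1
  ext f f'
  simp only [prodOp, hV, Matrix.mul_apply, Matrix.conjTranspose_apply, prod_sum_eq_sum_prod,
    Finset.prod_mul_distrib, star_prod]

lemma prodOp_isDensity {X : Fin T → Matrix I I ℂ} (h : ∀ t, IsDensity (X t)) :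
    IsDensity (prodOp X) :=
  ⟨prodOp_posSemidef fun t => (h t).1, by simp [trace_prodOp, (h _).2]⟩

lemma prodOp_sum {ι : Type*} [Fintype ι] (X : Fin T → ι → Matrix I I ℂ) :
    prodOp (fun t => ∑ i, X t i) = ∑ g : Fin T → ι, prodOp fun t => X t (g t) := by
  ext f f'
  simp only [prodOp, Matrix.sum_apply, prod_sum_eq_sum_prod]

lemma prodOp_smul (c : Fin T → ℂ) (X : Fin T → Matrix I I ℂ) :
    prodOp (fun t => c t • X t) = (∏ t, c t) • prodOp X := by
  ext f f'
  simp [prodOp, Finset.prod_mul_distrib]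

lemma reduced_prodOp (t : Fin T) (X : Fin T → Matrix I I ℂ) :
    reduced t (prodOp X) = (∏ t' ∈ Finset.univ.erase t, (X t').trace) • X t := by
  ext i i'
  -- The constraint on slot t becomes a factor of slot t, so that the sum over index functions
  -- factors into sums over single slots.
  have h : ∀ f : Fin T → I, (if f t = i then prodOp X f (Function.update f t i') else 0)
      = ∏ t', if t' = t then (if f t' = i then X t i i' else 0) else X t' (f t') (f t') := by
    intro f
    rw [← Finset.mul_prod_erase _ _ (Finset.mem_univ t)]
    simp only [if_true]
    split_ifs with hf
    · rw [prodOp, ← Finset.mul_prod_erase _ _ (Finset.mem_univ t)]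
      simp only [Function.update_self, hf]
      congr 1
      refine Finset.prod_congr rfl fun t' ht' => ?_
      have := Finset.ne_of_mem_erase ht'
      simp [this]
    · simp
  simp only [reduced, h]
  rw [← prod_sum_eq_sum_prod (fun t' j => if t' = t then (if j = i then X t i i' else 0)
    else X t' j j), ← Finset.mul_prod_erase _ _ (Finset.mem_univ t)]
  simp only [if_true, Finset.sum_ite_eq', Finset.mem_univ, Matrix.smul_apply, smul_eq_mul]
  rw [mul_comm]
  congr 1
  refine Finset.prod_congr rfl fun t' ht' => ?_
  simp [Finset.ne_of_mem_erase ht', Matrix.trace]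

lemma reduced_sum {ι : Type*} (s : Finset ι) (t : Fin T) (c : ι → ℂ)
    (X : ι → Matrix (Fin T → I) (Fin T → I) ℂ) :
    reduced t (∑ i ∈ s, c i • X i) = ∑ i ∈ s, c i • reduced t (X i) := by
  ext i i'
  simp only [reduced, Matrix.sum_apply, Matrix.smul_apply, smul_eq_mul, Finset.mul_sum]
  rw [Finset.sum_comm]
  refine Finset.sum_congr rfl fun f _ => ?_
  split_ifs <;> simp

end Products

/-! ### Classical information theory: random coding, mutual information, Fano -/

section Distributions

variable {X Y K : Type} [Fintype X] [Fintype Y] [Fintype K] [DecidableEq K]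

/-- Probability distributions on a finite type. -/
def IsDist (q : X → ℝ) : Prop := (∀ x, 0 ≤ q x) ∧ ∑ x, q x = 1

/-- The distribution of `K` independent copies. -/
def prodDist (K : Type) [Fintype K] (q : X → ℝ) : (K → X) → ℝ := fun x => ∏ k, q (x k)

/-- The product of `K` copies of a classical channel. -/
def prodLaw (K : Type) [Fintype K] (W : X → Y → ℝ) : (K → X) → (K → Y) → ℝ :=
  fun x y => ∏ k, W (x k) (y k)

/-- The output distribution of a classical channel. -/
def outDist (q : X → ℝ) (W : X → Y → ℝ) (y : Y) : ℝ := ∑ x, q x * W x y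

/-- The mutual information, in bits, between the input and the output of a classical channel. -/
def mutualInfo (q : X → ℝ) (W : X → Y → ℝ) : ℝ :=
  ∑ x, ∑ y, q x * W x y * Real.logb 2 (W x y / outDist q W y)

lemma IsDist.prodDist {q : X → ℝ} (h : IsDist q) : IsDist (prodDist K q) :=
  ⟨fun _ => Finset.prod_nonneg fun _ _ => h.1 _, by
    simp only [JCID.prodDist, ← prod_sum_eq_sum_prod (fun _ : K => q), h.2, Finset.prod_const_one]⟩

lemma isDist_prodLaw {W : X → Y → ℝ} (h : ∀ x, IsDist (W x)) (x : K → X) :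
    IsDist (prodLaw K W x) :=
  ⟨fun _ => Finset.prod_nonneg fun _ _ => (h _).1 _, by
    simp only [prodLaw, ← prod_sum_eq_sum_prod (fun k : K => W (x k)), (h _).2,
      Finset.prod_const_one]⟩

lemma outDist_prod (q : X → ℝ) (W : X → Y → ℝ) (y : K → Y) :
    outDist (prodDist K q) (prodLaw K W) y = ∏ k, outDist q W (y k) := by
  simp only [outDist, prodDist, prodLaw, prod_sum_eq_sum_prod, Finset.prod_mul_distrib]

lemma outDist_nonneg {q : X → ℝ} {W : X → Y → ℝ} (hq : IsDist q) (hW : ∀ x, IsDist (W x)) (y : Y) :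
    0 ≤ outDist q W y :=
  Finset.sum_nonneg fun x _ => mul_nonneg (hq.1 x) ((hW x).1 y)

lemma outDist_pos {q : X → ℝ} {W : X → Y → ℝ} (hq : IsDist q) (hW : ∀ x, IsDist (W x)) {x : X}
    {y : Y} (h : q x * W x y ≠ 0) : 0 < outDist q W y :=
  lt_of_lt_of_le (lt_of_le_of_ne (mul_nonneg (hq.1 x) ((hW x).1 y)) h.symm)
    (Finset.single_le_sum (f := fun x => q x * W x y)
      (fun x _ => mul_nonneg (hq.1 x) ((hW x).1 y)) (Finset.mem_univ x))

lemma sum_prodDist_mul {q : X → ℝ} (hq : ∑ x, q x = 1) (f : X → ℝ) (w : K) :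
    ∑ C, prodDist K q C * f (C w) = ∑ x, q x * f x := by
  have h : ∀ C : K → X, prodDist K q C * f (C w)
      = ∏ i, (q (C i) * if i = w then f (C i) else 1) := fun C => by
    rw [Finset.prod_mul_distrib, Finset.prod_ite_eq' Finset.univ w fun i => f (C i)]
    simp [prodDist]
  simp only [h]
  rw [← prod_sum_eq_sum_prod (fun i x => q x * if i = w then f x else 1),
    Finset.prod_eq_single w (fun i _ hi => by simp [hi, hq]) (by simp)]
  simp

/-- Independence of two distinct codewords; all other codewords sum out to one. -/
lemma sum_prodDist_mul_mul {q : X → ℝ} (hq : ∑ x, q x = 1) (f g : X → ℝ) {w v : K} (hwv : w ≠ v) :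
    ∑ C, prodDist K q C * (f (C w) * g (C v)) = (∑ x, q x * f x) * ∑ x, q x * g x := by
  have h : ∀ C : K → X, prodDist K q C * (f (C w) * g (C v))
      = ∏ i, (q (C i) * ((if i = w then f (C i) else 1) * if i = v then g (C i) else 1)) :=
    fun C => by
    rw [Finset.prod_mul_distrib, Finset.prod_mul_distrib,
      Finset.prod_ite_eq' Finset.univ w fun i => f (C i),
      Finset.prod_ite_eq' Finset.univ v fun i => g (C i)]
    simp [prodDist]
  simp only [h]
  rw [← prod_sum_eq_sum_prod
    (fun i x => q x * ((if i = w then f x else 1) * if i = v then g x else 1)),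
    Finset.prod_eq_mul w v hwv (fun i _ hi => by simp [hi, hq]) (by simp) (by simp)]
  simp [hwv, hwv.symm]

/-- Random coding: the error probability of threshold decoding, averaged over codebooks with
independent entries. -/
lemma exists_decoder {q : X → ℝ} {W : X → Y → ℝ} (hq : IsDist q) (hW : ∀ x, IsDist (W x))
    {τ : ℝ} (hτ : 0 < τ) {M : ℕ} (hM : 0 < M) :
    ∃ g : (Fin M → X) → Y → Fin M, ∀ w,
      ∑ C, prodDist (Fin M) q C * ∑ y, (if g C y ≠ w then W (C w) y else 0) ≤
        ∑ x, ∑ y, (if W x y ≤ τ * outDist q W y then q x * W x y else 0) + (M - 1) / τ := by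
  classical
  set Q := outDist q W with hQ
  -- The decoder names a message whose likelihood exceeds τ times the output probability, or an
  -- arbitrary one if there is none. An error then means that the true codeword misses the threshold
  -- or a wrong one passes it.
  have key : ∀ (C : Fin M → X) (y : Y), ∃ v : Fin M, ∀ w, v ≠ w →
      W (C w) y ≤ τ * Q y ∨ ∃ v', v' ≠ w ∧ τ * Q y < W (C v') y := by
    intro C y
    by_cases h : ∃ v, τ * Q y < W (C v) y
    · obtain ⟨v, hv⟩ := h
      exact ⟨v, fun w hw => Or.inr ⟨v, hw, hv⟩⟩
    · push Not at h
      exact ⟨⟨0, hM⟩, fun w _ => Or.inl (h w)⟩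
  choose g hg using key
  refine ⟨g, fun w => ?_⟩
  have hb : ∀ C : Fin M → X, ∑ y, (if g C y ≠ w then W (C w) y else 0) ≤
      ∑ y, (if W (C w) y ≤ τ * Q y then W (C w) y else 0) +
        ∑ v ∈ Finset.univ.erase w, ∑ y, W (C w) y * (if τ * Q y < W (C v) y then 1 else 0) := by
    intro C
    rw [Finset.sum_comm, ← Finset.sum_add_distrib]
    refine Finset.sum_le_sum fun y _ => ?_
    have h0 := (hW (C w)).1 y
    have h1 : 0 ≤ if W (C w) y ≤ τ * Q y then W (C w) y else 0 := by split_ifs <;> simp [h0]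
    have h2 : ∀ v ∈ Finset.univ.erase w,
        0 ≤ W (C w) y * (if τ * Q y < W (C v) y then (1 : ℝ) else 0) := fun v _ => by
      split_ifs <;> simp [h0]
    split_ifs with hgw hle hle
    · exact le_add_of_nonneg_right (Finset.sum_nonneg h2)
    · obtain h | ⟨v, hv, hlt⟩ := hg C y w hgw
      · exact absurd h hle
      · rw [zero_add]
        refine le_trans ?_ (Finset.single_le_sum h2 (Finset.mem_erase.2 ⟨hv, Finset.mem_univ v⟩))
        simp [hlt]
    · exact add_nonneg h0 (Finset.sum_nonneg h2)
    · exact add_nonneg le_rfl (Finset.sum_nonneg h2)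
  refine (Finset.sum_le_sum fun C _ =>
    mul_le_mul_of_nonneg_left (hb C) (hq.prodDist.1 C)).trans ?_
  simp only [mul_add, Finset.sum_add_distrib]
  refine add_le_add (le_of_eq ?_) ?_
  · rw [sum_prodDist_mul hq.2 (fun x => ∑ y, (if W x y ≤ τ * Q y then W x y else 0))]
    simp only [Finset.mul_sum, mul_ite, mul_zero]
  · have hv : ∀ v ∈ Finset.univ.erase w, ∑ C, prodDist (Fin M) q C *
        ∑ y, W (C w) y * (if τ * Q y < W (C v) y then 1 else 0) ≤ 1 / τ := by
      intro v hv
      have hwv := (Finset.ne_of_mem_erase hv).symm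
      simp only [Finset.mul_sum]
      rw [Finset.sum_comm]
      -- By independence this is Q y times the q-probability that τ Q y < W x y. Where that
      -- inequality holds, Q y ≤ W x y / τ, and W x y / τ sums over y to 1 / τ.
      have : ∀ y, ∑ C, prodDist (Fin M) q C * (W (C w) y * (if τ * Q y < W (C v) y then 1 else 0))
          ≤ ∑ x, q x * (W x y / τ) := by
        intro y
        rw [sum_prodDist_mul_mul hq.2 (fun x => W x y)
          (fun x => if τ * Q y < W x y then (1 : ℝ) else 0) hwv, Finset.mul_sum]
        refine Finset.sum_le_sum fun x _ => ?_
        change Q y * _ ≤ _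
        rw [mul_left_comm]
        refine mul_le_mul_of_nonneg_left ?_ (hq.1 x)
        split_ifs with h
        · rw [mul_one, le_div_iff₀ hτ, mul_comm]
          exact h.le
        · rw [mul_zero]
          exact div_nonneg ((hW x).1 y) hτ.le
      refine (Finset.sum_le_sum fun y _ => this y).trans (le_of_eq ?_)
      rw [Finset.sum_comm]
      simp only [← Finset.mul_sum, ← Finset.sum_div, (hW _).2]
      rw [← Finset.sum_mul, hq.2, one_mul]
    simp only [Finset.mul_sum (Finset.univ.erase w)]
    rw [Finset.sum_comm]
    refine (Finset.sum_le_sum hv).trans (le_of_eq ?_)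
    rw [Finset.sum_const, Finset.card_erase_of_mem (Finset.mem_univ w), Finset.card_univ,
      Fintype.card_fin, nsmul_eq_mul, Nat.cast_sub hM, Nat.cast_one, mul_one_div]

/-- A Chernoff bound for sums of independent copies of a finite random variable. -/
lemma exists_chernoff {r f : X → ℝ} (hr : IsDist r) {c : ℝ} (hc : c < ∑ x, r x * f x) :
    ∃ κ : ℝ, 0 ≤ κ ∧ κ < 1 ∧ ∀ n : ℕ,
      ∑ x : Fin n → X, (if ∑ k, f (x k) ≤ n * c then prodDist (Fin n) r x else 0) ≤ κ ^ n := by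
  set u : X → ℝ := fun x => f x - c with hu
  set m := ∑ x, r x * u x with hm
  have hmpos : 0 < m := by
    have : m = ∑ x, r x * f x - c := by
      simp only [hm, hu, mul_sub, Finset.sum_sub_distrib, ← Finset.sum_mul, hr.2, one_mul]
    linarith
  set B := 1 + ∑ x, |u x| with hB
  have hBpos : 0 < B := by positivity
  have hub : ∀ x, |u x| ≤ B := fun x => by
    have := Finset.single_le_sum (f := fun x => |u x|) (fun _ _ => abs_nonneg _) (Finset.mem_univ x)
    linarith
  -- The first bound makes |s u| ≤ 1, so that exp (-s u) ≤ 1 - s u + s² u². The second makes s² B²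
  -- at most s m / 2, so that the moment generating function is at most 1 - s m / 2 < 1.
  set s := min (1 / B) (m / (2 * B ^ 2)) with hs
  have hspos : 0 < s := lt_min (by positivity) (by positivity)
  have hs1 : s * B ≤ 1 := by
    have := min_le_left (1 / B) (m / (2 * B ^ 2))
    rwa [← hs, le_div_iff₀ hBpos] at this
  have hs2 : s * B ^ 2 ≤ m / 2 := by
    have := min_le_right (1 / B) (m / (2 * B ^ 2))
    rw [← hs, le_div_iff₀ (by positivity)] at this
    linarith
  refine ⟨∑ x, r x * Real.exp (-(s * u x)),
    Finset.sum_nonneg fun x _ => mul_nonneg (hr.1 x) (Real.exp_nonneg _), ?_, fun n => ?_⟩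
  · have hx : ∀ x, r x * Real.exp (-(s * u x)) ≤ r x * (1 + s ^ 2 * B ^ 2) - s * (r x * u x) := by
      intro x
      have h1 : |-(s * u x)| ≤ 1 := by
        rw [abs_neg, abs_mul, abs_of_pos hspos]
        exact (mul_le_mul_of_nonneg_left (hub x) hspos.le).trans hs1
      have h2 := (abs_le.1 (Real.abs_exp_sub_one_sub_id_le h1)).2
      have h3 : (u x) ^ 2 ≤ B ^ 2 := sq_le_sq' (abs_le.1 (hub x)).1 (abs_le.1 (hub x)).2
      have h4 : s ^ 2 * u x ^ 2 ≤ s ^ 2 * B ^ 2 := mul_le_mul_of_nonneg_left h3 (sq_nonneg s)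
      have h5 : Real.exp (-(s * u x)) ≤ 1 + s ^ 2 * B ^ 2 - s * u x := by nlinarith
      nlinarith [mul_le_mul_of_nonneg_left h5 (hr.1 x)]
    refine (Finset.sum_le_sum fun x _ => hx x).trans_lt ?_
    rw [Finset.sum_sub_distrib, ← Finset.sum_mul, hr.2, ← Finset.mul_sum, ← hm]
    nlinarith
  -- Exponential Markov inequality: the weight exp (-s ∑ u) is at least one on the event and factors
  -- over the copies.
  · calc _ ≤ ∑ x : Fin n → X, ∏ k, (r (x k) * Real.exp (-(s * u (x k)))) := by
          refine Finset.sum_le_sum fun x _ => ?_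
          have h0 := hr.prodDist.1 x
          rw [Finset.prod_mul_distrib, ← Real.exp_sum]
          change _ ≤ prodDist (Fin n) r x * _
          split_ifs with h
          · refine le_mul_of_one_le_right h0 (Real.one_le_exp ?_)
            rw [Finset.sum_neg_distrib, ← Finset.mul_sum]
            have : ∑ k, u (x k) ≤ 0 := by
              simp only [hu, Finset.sum_sub_distrib, Finset.sum_const, Finset.card_univ,
                Fintype.card_fin, nsmul_eq_mul]
              linarith
            nlinarith
          · exact mul_nonneg h0 (Real.exp_nonneg _)
      _ = _ := by
          rw [← prod_sum_eq_sum_prod (fun _ x => r x * Real.exp (-(s * u x)))]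
          simp

lemma sum_arrow_prod {R : Type*} [AddCommMonoid R] (f : (K → X) → (K → Y) → R) :
    ∑ x, ∑ y, f x y = ∑ ω : K → X × Y, f (fun k => (ω k).1) fun k => (ω k).2 := by
  rw [← Fintype.sum_prod_type' f,
    ← (Equiv.arrowProdEquivProdArrow K (fun _ => X) (fun _ => Y)).sum_comp]
  rfl

lemma isDist_joint {q : X → ℝ} {W : X → Y → ℝ} (hq : IsDist q) (hW : ∀ x, IsDist (W x)) :
    IsDist (fun ω : X × Y => q ω.1 * W ω.1 ω.2) :=
  ⟨fun ω => mul_nonneg (hq.1 _) ((hW _).1 _), by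
    simp [Fintype.sum_prod_type, ← Finset.mul_sum, (hW _).2, hq.2]⟩

lemma mutualInfo_eq_sum_prod (q : X → ℝ) (W : X → Y → ℝ) :
    mutualInfo q W = ∑ ω : X × Y, q ω.1 * W ω.1 ω.2 *
      Real.logb 2 (W ω.1 ω.2 / outDist q W ω.2) := by
  rw [mutualInfo, Fintype.sum_prod_type]

lemma mutualInfo_prod {q : X → ℝ} {W : X → Y → ℝ} (hq : IsDist q) (hW : ∀ x, IsDist (W x)) :
    mutualInfo (prodDist K q) (prodLaw K W) = Fintype.card K * mutualInfo q W := by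
  have hj := isDist_joint hq hW
  rw [mutualInfo, sum_arrow_prod]
  have h : ∀ ω : K → X × Y, prodDist K q (fun k => (ω k).1) *
      prodLaw K W (fun k => (ω k).1) (fun k => (ω k).2) *
      Real.logb 2 (prodLaw K W (fun k => (ω k).1) (fun k => (ω k).2) /
        outDist (prodDist K q) (prodLaw K W) fun k => (ω k).2)
      = ∑ k, prodDist K (fun ω : X × Y => q ω.1 * W ω.1 ω.2) ω *
        Real.logb 2 (W (ω k).1 (ω k).2 / outDist q W (ω k).2) := by
    intro ω
    rw [outDist_prod, ← Finset.mul_sum]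
    simp only [prodDist, prodLaw]
    rw [← Finset.prod_mul_distrib, ← Finset.prod_div_distrib]
    -- Where the joint probability vanishes both sides are zero; elsewhere all ratios are nonzero
    -- and the logarithm of the product splits.
    by_cases h0 : ∏ k, q (ω k).1 * W (ω k).1 (ω k).2 = 0
    · simp [h0]
    · rw [Real.logb_prod]
      intro k _
      have := Finset.prod_ne_zero_iff.1 h0 k (Finset.mem_univ k)
      exact div_ne_zero (right_ne_zero_of_mul this) (outDist_pos hq hW this).ne'
  simp only [h]
  rw [Finset.sum_comm]
  simp only [sum_prodDist_mul hj.2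
    (fun ω : X × Y => Real.logb 2 (W ω.1 ω.2 / outDist q W ω.2))]
  rw [← mutualInfo_eq_sum_prod]
  simp

/-- The channel coding theorem, with a shared random codebook. -/
theorem exists_random_code {q : X → ℝ} {W : X → Y → ℝ} (hq : IsDist q) (hW : ∀ x, IsDist (W x))
    {c : ℝ} (hc : c < mutualInfo q W) {ε : ℝ} (hε : 0 < ε) :
    ∃ n M : ℕ, 0 < n ∧ 0 < M ∧ n * c ≤ Real.logb 2 M ∧
      ∃ g : (Fin M → Fin n → X) → (Fin n → Y) → Fin M, ∀ w,
        ∑ C, prodDist (Fin M) (prodDist (Fin n) q) C *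
          ∑ y, (if g C y ≠ w then prodLaw (Fin n) W (C w) y else 0) ≤ ε := by
  rcases le_or_gt c 0 with hc0 | hc0
  · refine ⟨1, 1, one_pos, one_pos, by simpa using hc0, fun _ _ => 0, fun w => ?_⟩
    simp [Subsingleton.elim (0 : Fin 1) w, hε.le]
  -- With threshold 2^(n c') and M the ceiling of 2^(n c), c' below the mutual information makes
  -- missing the threshold exponentially unlikely, and c' above c makes (M - 1) / τ at most 2^(n (c
  -- - c')).
  set c' := (c + mutualInfo q W) / 2 with hc'
  have hcc' : c < c' := by rw [hc']; linarith
  have hc'I : c' < mutualInfo q W := by rw [hc']; linarith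
  rw [mutualInfo_eq_sum_prod] at hc'I
  obtain ⟨κ, hκ0, hκ1, hκ⟩ := exists_chernoff (isDist_joint hq hW) hc'I
  have hlim : Filter.Tendsto (fun n : ℕ => κ ^ n + ((2 : ℝ) ^ (c - c')) ^ n) Filter.atTop
      (nhds (0 + 0)) :=
    (tendsto_pow_atTop_nhds_zero_of_lt_one hκ0 hκ1).add
      (tendsto_pow_atTop_nhds_zero_of_lt_one (by positivity)
        (Real.rpow_lt_one_of_one_lt_of_neg one_lt_two (by linarith)))
  rw [add_zero] at hlim
  obtain ⟨n, hn, hn0⟩ := ((hlim.eventually (gt_mem_nhds hε)).and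
    (Filter.eventually_gt_atTop 0)).exists
  have hMpos : 0 < ⌈(2 : ℝ) ^ (n * c)⌉₊ := Nat.ceil_pos.2 (by positivity)
  obtain ⟨g, hg⟩ := exists_decoder (hq.prodDist (K := Fin n)) (isDist_prodLaw (K := Fin n) hW)
    (τ := (2 : ℝ) ^ (n * c')) (by positivity) hMpos
  refine ⟨n, _, hn0, hMpos, ?_, g, fun w => (hg w).trans ?_⟩
  · rw [Real.le_logb_iff_rpow_le one_lt_two (by exact_mod_cast hMpos)]
    exact Nat.le_ceil _
  · refine le_trans (add_le_add ?_ ?_) hn.le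
    · refine le_trans ?_ (hκ n)
      rw [sum_arrow_prod]
      refine Finset.sum_le_sum fun ω _ => ?_
      have hnn := (isDist_joint hq hW).prodDist.1 ω
      have hprod : prodDist (Fin n) q (fun k => (ω k).1) *
          prodLaw (Fin n) W (fun k => (ω k).1) (fun k => (ω k).2)
          = prodDist (Fin n) (fun ω : X × Y => q ω.1 * W ω.1 ω.2) ω := by
        simp only [prodDist, prodLaw, Finset.prod_mul_distrib]
      rw [hprod]
      by_cases h0 : prodDist (Fin n) (fun ω : X × Y => q ω.1 * W ω.1 ω.2) ω = 0
      · simp [h0]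
      have hne := fun k => Finset.prod_ne_zero_iff.1 h0 k (Finset.mem_univ k)
      by_cases hle : prodLaw (Fin n) W (fun k => (ω k).1) (fun k => (ω k).2) ≤
          (2 : ℝ) ^ (n * c') * outDist (prodDist (Fin n) q) (prodLaw (Fin n) W) fun k => (ω k).2
      -- After taking logarithms, missing the threshold says that the information densities of the n
      -- letters sum to at most n c'.
      · rw [if_pos hle, if_pos]
        rw [outDist_prod] at hle
        have hQ : ∀ k, 0 < outDist q W (ω k).2 := fun k => outDist_pos hq hW (hne k)
        have hWp : ∀ k, 0 < W (ω k).1 (ω k).2 := fun k =>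
          lt_of_le_of_ne ((hW _).1 _) (right_ne_zero_of_mul (hne k)).symm
        rw [← Real.logb_prod _ _ fun k _ => (div_pos (hWp k) (hQ k)).ne',
          Real.logb_le_iff_le_rpow one_lt_two
            (Finset.prod_pos fun k _ => div_pos (hWp k) (hQ k)),
          Finset.prod_div_distrib, div_le_iff₀ (Finset.prod_pos fun k _ => hQ k)]
        exact hle
      · rw [if_neg hle]
        split_ifs
        exacts [hnn, le_rfl]
    · rw [div_le_iff₀ (by positivity), ← Real.rpow_natCast, ← Real.rpow_mul zero_le_two,
        ← Real.rpow_add two_pos]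
      have h := (Nat.ceil_lt_add_one (a := (2 : ℝ) ^ (n * c)) (by positivity)).le
      have : (c - c') * n + n * c' = n * c := by ring
      rw [this]
      linarith

lemma mutualInfo_eq_xlog {q : X → ℝ} {W : X → Y → ℝ} (hq : IsDist q) (hW : ∀ x, IsDist (W x)) :
    mutualInfo q W = ∑ x, q x * ∑ y, xlog (W x y) - ∑ y, xlog (outDist q W y) := by
  have h : ∀ x y, q x * W x y * Real.logb 2 (W x y / outDist q W y)
      = q x * xlog (W x y) - q x * W x y * Real.logb 2 (outDist q W y) := by
    intro x y
    by_cases h0 : q x * W x y = 0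
    · rw [h0, xlog, ← mul_assoc, h0]
      simp
    · rw [Real.logb_div (right_ne_zero_of_mul h0) (outDist_pos hq hW h0).ne', xlog]
      ring
  simp only [mutualInfo, h, Finset.sum_sub_distrib, Finset.mul_sum]
  congr 1
  rw [Finset.sum_comm]
  simp only [← Finset.sum_mul]
  rfl

/-- The variational lower bound on mutual information by a reverse channel. -/
lemma le_mutualInfo {q : X → ℝ} {W : X → Y → ℝ} (hq : IsDist q) (hW : ∀ x, IsDist (W x))
    {V : X → Y → ℝ} (hV : ∀ x y, 0 < V x y) (hV1 : ∀ y, ∑ x, V x y ≤ 1) :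
    ∑ x, ∑ y, q x * W x y * Real.logb 2 (V x y / q x) ≤ mutualInfo q W := by
  have h2 : 0 < Real.log 2 := Real.log_pos one_lt_two
  -- Termwise this is log z ≤ z - 1 at z = Q V / (q W), with Q the output distribution. The
  -- corrections have nonnegative sum, because q W has mass one and Q V mass at most one.
  have h : ∀ x y, q x * W x y * Real.logb 2 (V x y / q x) +
      (q x * W x y - outDist q W y * V x y) / Real.log 2
      ≤ q x * W x y * Real.logb 2 (W x y / outDist q W y) := by
    intro x y
    by_cases h0 : q x * W x y = 0
    · rw [h0, zero_mul, zero_mul, zero_add]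
      refine div_nonpos_of_nonpos_of_nonneg ?_ h2.le
      have := mul_nonneg (outDist_nonneg hq hW y) (hV x y).le
      linarith
    · have hQ := outDist_pos hq hW h0
      have hqx : 0 < q x := lt_of_le_of_ne (hq.1 x) (left_ne_zero_of_mul h0).symm
      have hWx : 0 < W x y := lt_of_le_of_ne ((hW x).1 y) (right_ne_zero_of_mul h0).symm
      have hVx := hV x y
      have hz : 0 < outDist q W y * V x y / (q x * W x y) := by positivity
      have hl := Real.log_le_sub_one_of_pos hz
      have e : Real.logb 2 (W x y / outDist q W y) - Real.logb 2 (V x y / q x)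
          = -(Real.log (outDist q W y * V x y / (q x * W x y)) / Real.log 2) := by
        simp only [Real.logb]
        rw [Real.log_div hWx.ne' hQ.ne', Real.log_div hVx.ne' hqx.ne',
          Real.log_div (by positivity) (by positivity), Real.log_mul hQ.ne' hVx.ne',
          Real.log_mul hqx.ne' hWx.ne']
        ring
      have h3 : (q x * W x y - outDist q W y * V x y) / Real.log 2 ≤ q x * W x y *
          -(Real.log (outDist q W y * V x y / (q x * W x y)) / Real.log 2) := by
        rw [mul_neg, ← mul_div_assoc, ← neg_div]
        refine div_le_div_of_nonneg_right ?_ h2.le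
        have h4 := mul_le_mul_of_nonneg_left hl (mul_pos hqx hWx).le
        rw [mul_sub, mul_div_cancel₀ _ (mul_pos hqx hWx).ne'] at h4
        linarith
      rw [← e, mul_sub] at h3
      linarith
  have hs := Finset.sum_le_sum fun x (_ : x ∈ Finset.univ) =>
    Finset.sum_le_sum fun y (_ : y ∈ Finset.univ) => h x y
  refine le_trans ?_ hs
  simp only [Finset.sum_add_distrib]
  refine le_add_of_nonneg_right ?_
  simp only [← Finset.sum_div, Finset.sum_sub_distrib]
  refine div_nonneg ?_ h2.le
  have e1 : ∑ x, ∑ y, q x * W x y = 1 := by simp [← Finset.mul_sum, (hW _).2, hq.2]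
  have e2 : ∑ x, ∑ y, outDist q W y * V x y ≤ 1 := by
    rw [Finset.sum_comm]
    simp only [← Finset.mul_sum]
    refine (Finset.sum_le_sum fun y _ =>
      mul_le_mul_of_nonneg_left (hV1 y) (outDist_nonneg hq hW y)).trans ?_
    simp only [mul_one, outDist]
    rw [Finset.sum_comm, e1]
  linarith

/-- A Fano-type inequality for uniform messages. -/
lemma fano {M : ℕ} (hM : 0 < M) {W : Fin M → Fin M → ℝ} (hW : ∀ w, IsDist (W w)) {ε : ℝ}
    (hε : 0 < ε) (hε1 : ε < 1) (h : ∀ w, 1 - ε ≤ W w w) :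
    (1 - ε) * Real.logb 2 M + Real.logb 2 (1 - ε) + ε * Real.logb 2 ε ≤
      mutualInfo (fun _ => 1 / (M : ℝ)) W := by
  have hM' : (0 : ℝ) < M := by exact_mod_cast hM
  have hM1 : (1 : ℝ) ≤ M := by exact_mod_cast hM
  have hq : IsDist (fun _ : Fin M => 1 / (M : ℝ)) := ⟨fun _ => by positivity, by simp [hM'.ne']⟩
  have hε' : 0 < 1 - ε := by linarith
  -- The reverse channel trusts the decoded message with weight 1 - ε and spreads ε uniformly.
  -- Relative to the uniform input it has density M (1 - ε) + ε on the diagonal and ε elsewhere.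
  refine le_trans ?_ (le_mutualInfo hq hW (V := fun w v => (if w = v then 1 - ε else 0) + ε / M)
    (fun w v => by
      have : 0 < ε / M := by positivity
      split_ifs <;> linarith) fun v => le_of_eq ?_)
  · have hw : ∀ w, (1 - ε) * Real.logb 2 M + Real.logb 2 (1 - ε) + ε * Real.logb 2 ε ≤
        ∑ v, W w v * Real.logb 2 (((if w = v then 1 - ε else 0) + ε / M) / (1 / (M : ℝ))) := by
      intro w
      have hs := (hW w).2
      rw [← Finset.add_sum_erase _ _ (Finset.mem_univ w)] at hs ⊢
      have e : ∀ v ∈ Finset.univ.erase w,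
          W w v * Real.logb 2 (((if w = v then 1 - ε else 0) + ε / M) / (1 / (M : ℝ)))
          = W w v * Real.logb 2 ε := by
        intro v hv
        rw [if_neg (Finset.ne_of_mem_erase hv).symm, zero_add]
        congr 2
        field_simp
      rw [Finset.sum_congr rfl e, ← Finset.sum_mul, if_pos rfl]
      have e2 : (1 - ε + ε / M) / (1 / (M : ℝ)) = M * (1 - ε) + ε := by field_simp
      rw [e2]
      set L := Real.logb 2 (M * (1 - ε) + ε) with hL
      have hL0 : 0 ≤ L := Real.logb_nonneg one_lt_two (by nlinarith)
      have hL1 : Real.logb 2 M + Real.logb 2 (1 - ε) ≤ L := by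
        rw [← Real.logb_mul hM'.ne' hε'.ne']
        exact Real.logb_le_logb_of_le one_lt_two (by positivity) (by linarith)
      have hl1 : Real.logb 2 (1 - ε) ≤ 0 := Real.logb_nonpos one_lt_two hε'.le (by linarith)
      have hl2 : Real.logb 2 ε ≤ 0 := Real.logb_nonpos one_lt_two hε.le hε1.le
      have hsum : ∑ v ∈ Finset.univ.erase w, W w v = 1 - W w w := by linarith
      rw [hsum]
      have h1 := mul_le_mul_of_nonneg_right (h w) hL0
      have h2 := mul_le_mul_of_nonneg_left hL1 hε'.le
      have h3 : ε * Real.logb 2 ε ≤ (1 - W w w) * Real.logb 2 ε :=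
        mul_le_mul_of_nonpos_right (by linarith [h w]) hl2
      nlinarith
    have : ∑ w : Fin M, 1 / (M : ℝ) *
        ((1 - ε) * Real.logb 2 M + Real.logb 2 (1 - ε) + ε * Real.logb 2 ε)
        = (1 - ε) * Real.logb 2 M + Real.logb 2 (1 - ε) + ε * Real.logb 2 ε := by
      rw [← Finset.sum_mul, hq.2, one_mul]
    rw [← this]
    refine Finset.sum_le_sum fun w _ => ?_
    simp only [mul_assoc, ← Finset.mul_sum]
    exact mul_le_mul_of_nonneg_left (hw w) (hq.1 w)
  · simp only [Finset.sum_add_distrib, Finset.sum_ite_eq', Finset.mem_univ, if_true]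
    simp only [Finset.sum_const, Finset.card_univ, Fintype.card_fin, nsmul_eq_mul]
    rw [mul_div_cancel₀ _ hM'.ne']
    ring

/-- The mutual information of a channel that is selected at random, with the selection known to
the sender and the receiver. -/
lemma mutualInfo_mix {X' Y' : Type} [Fintype X'] [Fintype Y'] {q : X → ℝ} {q' : X' → ℝ}
    (hq : IsDist q) (hq' : IsDist q') (W : X → Y → ℝ) (W' : X' → Y' → ℝ) (a b : ℝ) :
    mutualInfo (fun x : X × X' => q x.1 * q' x.2)
      (fun x => Sum.elim (fun y => a * W x.1 y) fun y => b * W' x.2 y)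
      = a * mutualInfo q W + b * mutualInfo q' W' := by
  have h1 : ∀ y, outDist (fun x : X × X' => q x.1 * q' x.2)
      (fun x => Sum.elim (fun y => a * W x.1 y) fun y => b * W' x.2 y) (Sum.inl y)
      = a * outDist q W y := by
    intro y
    simp only [outDist, Sum.elim_inl, Fintype.sum_prod_type, Finset.mul_sum]
    refine Finset.sum_congr rfl fun x _ => ?_
    rw [← Finset.sum_mul, ← Finset.mul_sum, hq'.2]
    ring
  have h2 : ∀ y, outDist (fun x : X × X' => q x.1 * q' x.2)
      (fun x => Sum.elim (fun y => a * W x.1 y) fun y => b * W' x.2 y) (Sum.inr y)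
      = b * outDist q' W' y := by
    intro y
    simp only [outDist, Sum.elim_inr, Fintype.sum_prod_type_right, Finset.mul_sum]
    refine Finset.sum_congr rfl fun x _ => ?_
    rw [← Finset.sum_mul, ← Finset.sum_mul, hq.2]
    ring
  -- The selection probability cancels in the likelihood ratio; if it is zero, both sides vanish.
  have h3 : ∀ c u v : ℝ, c * u * Real.logb 2 (c * u / (c * v)) = c * (u * Real.logb 2 (u / v)) := by
    intro c u v
    rcases eq_or_ne c 0 with rfl | hc
    · simp
    · rw [mul_div_mul_left _ _ hc, mul_assoc]
  simp only [mutualInfo, Fintype.sum_sum_type, h1, h2, Sum.elim_inl, Sum.elim_inr,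
    Finset.sum_add_distrib]
  congr 1
  · rw [Fintype.sum_prod_type, Finset.mul_sum]
    refine Finset.sum_congr rfl fun x _ => ?_
    rw [Finset.sum_comm, Finset.mul_sum]
    refine Finset.sum_congr rfl fun y _ => ?_
    simp only [mul_assoc (_ * _ : ℝ) (_ * _), h3]
    rw [← Finset.sum_mul, ← Finset.mul_sum, hq'.2]
    ring
  · rw [Fintype.sum_prod_type_right, Finset.mul_sum]
    refine Finset.sum_congr rfl fun x _ => ?_
    rw [Finset.sum_comm, Finset.mul_sum]
    refine Finset.sum_congr rfl fun y _ => ?_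
    simp only [mul_assoc (_ * _ : ℝ) (_ * _), h3]
    rw [← Finset.sum_mul, ← Finset.sum_mul, hq.2]
    ring

end Distributions

/-! ### Schemes: block channels with common randomness, and operations on them -/

section Schemes

variable {I J A B Q X : Type} [Fintype I] [DecidableEq I] [Fintype J] [DecidableEq J]
  [Fintype A] [DecidableEq A] [Fintype B] [DecidableEq B] [Fintype Q] [DecidableEq Q]

/-- The operators `F x s r`, left by the outcome `r` of the detection for input `x` and channel state
`s`, are those of an encoder and an instrument that share the state `φ`. -/
def IsDevice (N : Fin 2 → Matrix I I ℂ →ₗ[ℂ] Matrix J J ℂ) (φ : Matrix (A × B) (A × B) ℂ)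
    (F : X → Fin 2 → Fin 2 → Matrix Q Q ℂ) : Prop :=
  ∃ (enc : X → Matrix A A ℂ →ₗ[ℂ] Matrix I I ℂ)
    (instr : Fin 2 → Matrix (J × B) (J × B) ℂ →ₗ[ℂ] Matrix Q Q ℂ),
    (∀ x, IsChannel (enc x)) ∧ IsInstrument instr ∧
      ∀ x s r, F x s r = instr r (onLeft B (N s) (onLeft B (enc x) φ))

variable {N : Fin 2 → Matrix I I ℂ →ₗ[ℂ] Matrix J J ℂ} {φ : Matrix (A × B) (A × B) ℂ}

lemma IsDevice.comap {X' : Type} {F : X → Fin 2 → Fin 2 → Matrix Q Q ℂ} (h : IsDevice N φ F)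
    (f : X' → X) : IsDevice N φ fun x => F (f x) := by
  obtain ⟨enc, instr, h1, h2, h3⟩ := h
  exact ⟨fun x => enc (f x), instr, fun x => h1 _, h2, fun x => h3 _⟩

lemma IsDevice.map {Q' : Type} [Fintype Q'] [DecidableEq Q']
    {F : X → Fin 2 → Fin 2 → Matrix Q Q ℂ} (h : IsDevice N φ F)
    {Ψ : Matrix Q Q ℂ →ₗ[ℂ] Matrix Q' Q' ℂ} (hΨ : IsChannel Ψ) :
    IsDevice N φ fun x s r => Ψ (F x s r) := by
  obtain ⟨enc, instr, h1, h2, h3⟩ := h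
  refine ⟨enc, fun r => Ψ ∘ₗ instr r, h1, ⟨fun r => hΨ.1.comp (h2.1 r), fun X => ?_⟩,
    fun x s r => congrArg Ψ (h3 x s r)⟩
  simp only [LinearMap.comp_apply, ← map_sum, hΨ.2, h2.2]

lemma IsDevice.posSemidef {F : X → Fin 2 → Fin 2 → Matrix Q Q ℂ} (h : IsDevice N φ F)
    (hN : ∀ s, IsChannel (N s)) (hφ : IsDensity φ) (x : X) (s r : Fin 2) :
    (F x s r).PosSemidef := by
  obtain ⟨enc, instr, h1, h2, h3⟩ := h
  rw [h3]
  exact (h2.1 r).posSemidef ((hN s).isDensity_onLeft ((h1 x).isDensity_onLeft hφ)).1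

lemma IsDevice.trace_sum {F : X → Fin 2 → Fin 2 → Matrix Q Q ℂ} (h : IsDevice N φ F)
    (hN : ∀ s, IsChannel (N s)) (hφ : IsDensity φ) (x : X) (s : Fin 2) :
    (∑ r, F x s r).trace = 1 := by
  obtain ⟨enc, instr, h1, h2, h3⟩ := h
  simp only [h3, h2.2]
  exact ((hN s).isDensity_onLeft ((h1 x).isDensity_onLeft hφ)).2

/-- A block of `T` channel uses with inputs in `X`, outputs in `Y`, and common randomness in `Z`, in
which the sender and the receiver share the state `φ` in every slot, and the receiver is left with
`Q` in every slot. -/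
structure Scheme (N : Fin 2 → Matrix I I ℂ →ₗ[ℂ] Matrix J J ℂ) (φ : Matrix (A × B) (A × B) ℂ)
    (T : ℕ) (X Y Z Q : Type) [Fintype X] [Fintype Y] [Fintype Z] [Fintype Q] [DecidableEq Q] where
  /-- the input distribution -/
  q : X → ℝ
  q_dist : IsDist q
  /-- the distribution of the common randomness -/
  p : Z → ℝ
  p_dist : IsDist p
  /-- the operators after detection -/
  F : Fin T → Z → X → Fin 2 → Fin 2 → Matrix Q Q ℂ
  device : ∀ t z, IsDevice N φ (F t z)
  /-- the measurement of the block -/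
  povm : Z → Y → Matrix (Fin T → Q) (Fin T → Q) ℂ
  povm_povm : ∀ z, IsPOVM (povm z)

namespace Scheme

variable {T : ℕ} {X Y Z Q : Type} [Fintype X] [Fintype Y] [Fintype Z] [Fintype Q] [DecidableEq Q]
  (S : Scheme N φ T X Y Z Q) (θ π : Fin 2 → ℝ)

/-- The state left in a slot, averaged over the channel states and the detection results. -/
def avg (t : Fin T) (z : Z) (x : X) : Matrix Q Q ℂ := ∑ s, (θ s : ℂ) • ∑ r, S.F t z x s r

/-- The classical channel from the input to the output of the block. -/
def law (x : X) (y : Y) : ℝ :=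
  ∑ z, S.p z * (S.povm z y * prodOp fun t => S.avg θ t z x).trace.re

/-- The probability of the detection result `r` for the channel state `s`. -/
def detect (t : Fin T) (s r : Fin 2) : ℝ :=
  ∑ x, S.q x * ∑ z, S.p z * (S.F t z x s r).trace.re

/-- The detection error in slot `t`. -/
def detectErr (t : Fin T) : ℝ := π 0 * S.detect t 0 1 + π 1 * S.detect t 1 0

lemma avg_isDensity (hN : ∀ s, IsChannel (N s)) (hφ : IsDensity φ) (hθ : IsDist θ) (t : Fin T)
    (z : Z) (x : X) : IsDensity (S.avg θ t z x) := by
  refine ⟨Matrix.posSemidef_sum _ fun s _ => (Matrix.posSemidef_sum _ fun r _ =>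
    (S.device t z).posSemidef hN hφ x s r).smul (by exact_mod_cast hθ.1 s), ?_⟩
  rw [avg, Matrix.trace_sum]
  simp only [Matrix.trace_smul, (S.device t z).trace_sum hN hφ, smul_eq_mul, mul_one]
  exact_mod_cast hθ.2

lemma law_isDist (hN : ∀ s, IsChannel (N s)) (hφ : IsDensity φ) (hθ : IsDist θ) (x : X) :
    IsDist (S.law θ x) := by
  have hd := fun z => prodOp_isDensity fun t => S.avg_isDensity θ hN hφ hθ t z x
  refine ⟨fun y => Finset.sum_nonneg fun z _ => mul_nonneg (S.p_dist.1 z)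
    (trace_mul_re_nonneg ((S.povm_povm z).1 y) (hd z).1), ?_⟩
  simp only [law]
  rw [Finset.sum_comm]
  simp only [← Finset.mul_sum, ← Complex.re_sum, ← Matrix.trace_sum, ← Finset.sum_mul,
    (S.povm_povm _).2, one_mul, (hd _).2, Complex.one_re, mul_one]
  exact S.p_dist.2

/-- Enlarge the system `Q` by a system in a fixed pure state. -/
def widen {Q' E : Type} [Fintype Q'] [DecidableEq Q'] [Fintype E] [DecidableEq E]
    (e : Q' ≃ Q × E) (e₀ : E) : Scheme N φ T X Y Z Q' where
  q := S.q
  q_dist := S.q_dist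
  p := S.p
  p_dist := S.p_dist
  F t z x s r := (submatrixMap e ∘ₗ appendMap (Matrix.single e₀ e₀ 1)) (S.F t z x s r)
  device t z := (S.device t z).map (Ψ := submatrixMap e ∘ₗ appendMap (Matrix.single e₀ e₀ 1))
    ⟨(isCP_submatrixMap e).comp (isCP_appendMap (isDensity_single e₀).1), fun X => by
      simp only [LinearMap.comp_apply, submatrixMap_apply, appendMap_apply]
      rw [trace_submatrix_equiv, Matrix.trace_kronecker, (isDensity_single e₀).2, mul_one]⟩
  povm z y := ((S.povm z y) ⊗ₖ (1 : Matrix (Fin T → E) (Fin T → E) ℂ)).submatrix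
    (fun f => (fun t => (e (f t)).1, fun t => (e (f t)).2))
    (fun f => (fun t => (e (f t)).1, fun t => (e (f t)).2))
  povm_povm z := by
    refine ⟨fun y => (((S.povm_povm z).1 y).kronecker Matrix.PosSemidef.one).submatrix _, ?_⟩
    ext f f'
    have := congrFun (congrFun (S.povm_povm z).2 (fun t => (e (f t)).1)) fun t => (e (f' t)).1
    simp only [Matrix.sum_apply] at this
    simp only [Matrix.sum_apply, Matrix.submatrix_apply, Matrix.kronecker_apply, ← Finset.sum_mul,
      this, Matrix.one_apply]
    have h : f = f' ↔ (fun t => (e (f t)).1) = (fun t => (e (f' t)).1) ∧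
        (fun t => (e (f t)).2) = (fun t => (e (f' t)).2) := by
      simp only [funext_iff, ← forall_and, ← Prod.ext_iff, e.injective.eq_iff]
    simp only [h, ite_and, mul_ite, mul_one, mul_zero]
    split_ifs <;> rfl

section Widen

variable {Q' E : Type} [Fintype Q'] [DecidableEq Q'] [Fintype E] [DecidableEq E]
    (e : Q' ≃ Q × E) (e₀ : E)

lemma widen_trace_F (t : Fin T) (z : Z) (x : X) (s r : Fin 2) :
    ((S.widen e e₀).F t z x s r).trace = (S.F t z x s r).trace := by
  simp only [widen, LinearMap.comp_apply, submatrixMap_apply, appendMap_apply]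
  rw [trace_submatrix_equiv, Matrix.trace_kronecker, (isDensity_single e₀).2, mul_one]

lemma widen_detect (t : Fin T) (s r : Fin 2) :
    (S.widen e e₀).detect t s r = S.detect t s r := by
  simp only [detect, widen_trace_F]
  rfl

/-- The added system is a product factor of trace one that the block measurement ignores. Widening
gives two schemes the same residual system, as `mix` requires. -/
lemma widen_law (x : X) (y : Y) : (S.widen e e₀).law θ x y = S.law θ x y := by
  have havg : ∀ t z, (S.widen e e₀).avg θ t z x
      = (S.avg θ t z x ⊗ₖ Matrix.single e₀ e₀ 1).submatrix e e := by
    intro t z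
    simp only [avg, widen, ← map_sum, ← map_smul]
    rfl
  simp only [law]
  refine Finset.sum_congr rfl fun z _ => ?_
  refine congrArg (fun c : ℂ => S.p z * c.re) ?_
  let g : (Fin T → Q') ≃ (Fin T → Q) × (Fin T → E) :=
    (Equiv.arrowCongr (Equiv.refl _) e).trans (Equiv.arrowProdEquivProdArrow _ _ _)
  have hp : (prodOp fun t => (S.widen e e₀).avg θ t z x)
      = ((prodOp fun t => S.avg θ t z x) ⊗ₖ
          (prodOp fun _ : Fin T => Matrix.single e₀ e₀ (1 : ℂ))).submatrix g g := by
    ext f f'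
    simp only [prodOp, havg, Matrix.submatrix_apply, Matrix.kroneckerMap_apply,
      Finset.prod_mul_distrib]
    rfl
  have hv : (S.widen e e₀).povm z y = ((S.povm z y) ⊗ₖ
      (1 : Matrix (Fin T → E) (Fin T → E) ℂ)).submatrix g g := rfl
  rw [hp, hv, Matrix.submatrix_mul_equiv, trace_submatrix_equiv, ← Matrix.mul_kronecker_mul,
    Matrix.trace_kronecker, one_mul, trace_prodOp]
  simp

end Widen

/-- Use one of two schemes, selected at random by common randomness. -/
def mix {X' Y' Z' : Type} [Fintype X'] [Fintype Y'] [Fintype Z'] (S' : Scheme N φ T X' Y' Z' Q)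
    {a b : ℝ} (ha : 0 ≤ a) (hb : 0 ≤ b) (hab : a + b = 1) :
    Scheme N φ T (X × X') (Y ⊕ Y') (Z ⊕ Z') Q where
  q x := S.q x.1 * S'.q x.2
  q_dist := ⟨fun x => mul_nonneg (S.q_dist.1 _) (S'.q_dist.1 _), by
    simp [Fintype.sum_prod_type, ← Finset.mul_sum, S.q_dist.2, S'.q_dist.2]⟩
  p := Sum.elim (fun z => a * S.p z) fun z => b * S'.p z
  p_dist := ⟨by
    rintro (z | z)
    exacts [mul_nonneg ha (S.p_dist.1 z), mul_nonneg hb (S'.p_dist.1 z)], by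
    simp [← Finset.mul_sum, S.p_dist.2, S'.p_dist.2, hab]⟩
  F t z x := Sum.elim (fun z => S.F t z x.1) (fun z => S'.F t z x.2) z
  device t z := by
    rcases z with z | z
    exacts [(S.device t z).comap Prod.fst, (S'.device t z).comap Prod.snd]
  povm := Sum.elim (fun z => Sum.elim (S.povm z) 0) fun z => Sum.elim 0 (S'.povm z)
  povm_povm := by
    rintro (z | z)
    · refine ⟨?_, by simp [(S.povm_povm z).2]⟩
      rintro (y | y)
      exacts [(S.povm_povm z).1 y, Matrix.PosSemidef.zero]
    · refine ⟨?_, by simp [(S'.povm_povm z).2]⟩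
      rintro (y | y)
      exacts [Matrix.PosSemidef.zero, (S'.povm_povm z).1 y]

section Mix

variable {X' Y' Z' : Type} [Fintype X'] [Fintype Y'] [Fintype Z'] (S' : Scheme N φ T X' Y' Z' Q)
    {a b : ℝ} (ha : 0 ≤ a) (hb : 0 ≤ b) (hab : a + b = 1)

/-- The summand of the output names the selected scheme: measurement elements of the other summand
are zero, so no cross terms appear. -/
lemma mix_law (x : X × X') : (S.mix S' ha hb hab).law θ x
    = Sum.elim (fun y => a * S.law θ x.1 y) fun y => b * S'.law θ x.2 y := by
  funext y
  rcases y with y | y <;>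
    simp [law, mix, avg, Finset.mul_sum, mul_assoc]

/-- Selecting a scheme for the whole block averages the detection probabilities in each slot
separately, as a bound on the worst slot requires. -/
lemma mix_detect (t : Fin T) (s r : Fin 2) : (S.mix S' ha hb hab).detect t s r
    = a * S.detect t s r + b * S'.detect t s r := by
  simp only [detect, mix, Fintype.sum_sum_type, Sum.elim_inl, Sum.elim_inr, mul_add,
    Finset.sum_add_distrib, mul_assoc a, mul_assoc b, ← Finset.mul_sum]
  congr 1
  · rw [Fintype.sum_prod_type, Finset.mul_sum]
    refine Finset.sum_congr rfl fun x _ => ?_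
    dsimp only
    rw [← Finset.sum_mul, ← Finset.mul_sum, S'.q_dist.2]
    ring
  · rw [Fintype.sum_prod_type_right, Finset.mul_sum]
    refine Finset.sum_congr rfl fun x _ => ?_
    dsimp only
    rw [← Finset.sum_mul, ← Finset.sum_mul, S.q_dist.2]
    ring

end Mix

/-- Independent repetitions of a scheme. -/
def repeated {K : Type} [Fintype K] [DecidableEq K] {T' : ℕ} (e : Fin T' ≃ K × Fin T) :
    Scheme N φ T' (K → X) (K → Y) (K → Z) Q where
  q := prodDist K S.q
  q_dist := S.q_dist.prodDist
  p := prodDist K S.p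
  p_dist := S.p_dist.prodDist
  F t z x := S.F (e t).2 (z (e t).1) (x (e t).1)
  device t z := (S.device _ _).comap fun x : K → X => x (e t).1
  povm z y := Matrix.of fun f f' =>
    ∏ k, S.povm (z k) (y k) (fun t => f (e.symm (k, t))) fun t => f' (e.symm (k, t))
  povm_povm z := by
    constructor
    · intro y
      choose V hV using fun k => exists_eq_conjTranspose_mul_self ((S.povm_povm (z k)).1 (y k))
      -- The product element is the Gram matrix of the product of the factors V k, whose columns are
      -- relabelled by the slots of the long block.
      let W : Matrix (K → Fin T → Q) (Fin T' → Q) ℂ := Matrix.of fun g f =>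
        ∏ k, V k (g k) fun t => f (e.symm (k, t))
      convert Matrix.posSemidef_conjTranspose_mul_self W using 1
      ext f f'
      simp only [hV, Matrix.of_apply, Matrix.mul_apply, Matrix.conjTranspose_apply, prod_sum_eq_sum_prod,
        Finset.prod_mul_distrib, star_prod, W]
    · ext f f'
      simp only [Matrix.sum_apply, Matrix.of_apply]
      rw [← prod_sum_eq_sum_prod (fun k y => S.povm (z k) y (fun t => f (e.symm (k, t)))
        fun t => f' (e.symm (k, t)))]
      have : ∀ k, ∑ y, S.povm (z k) y (fun t => f (e.symm (k, t))) (fun t => f' (e.symm (k, t)))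
          = if (∀ t, f (e.symm (k, t)) = f' (e.symm (k, t))) then 1 else 0 := by
        intro k
        rw [← Matrix.sum_apply, (S.povm_povm (z k)).2, Matrix.one_apply]
        simp only [funext_iff]
      simp only [this, Finset.prod_ite_zero, Finset.prod_const_one, Matrix.one_apply,
        Finset.mem_univ, true_imp_iff]
      refine if_congr ?_ rfl rfl
      rw [funext_iff, ← Prod.forall (p := fun p => f (e.symm p) = f' (e.symm p)),
        e.symm.forall_congr_left]
      simp

section Repeated

variable {K : Type} [Fintype K] [DecidableEq K] {T' : ℕ} (e : Fin T' ≃ K × Fin T)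

lemma trace_repeated_povm_mul (z : K → Z) (y : K → Y) (x : K → X) :
    ((S.repeated e).povm z y * prodOp fun t => (S.repeated e).avg θ t z x).trace
      = ∏ k, (S.povm (z k) (y k) * prodOp fun t => S.avg θ t (z k) (x k)).trace := by
  let g : (Fin T' → Q) ≃ (K → Fin T → Q) :=
    (Equiv.arrowCongr e (Equiv.refl Q)).trans (Equiv.curry K (Fin T) Q)
  have hp : ∀ f f' : Fin T' → Q, prodOp (fun t => (S.repeated e).avg θ t z x) f f'
      = ∏ k, prodOp (fun t => S.avg θ t (z k) (x k)) (g f k) (g f' k) := by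
    intro f f'
    simp only [prodOp]
    rw [← Fintype.prod_prod_type', ← e.prod_comp]
    refine Finset.prod_congr rfl fun t _ => ?_
    simp [g, avg, repeated, Equiv.arrowCongr]
  simp only [Matrix.trace, Matrix.diag_apply, Matrix.mul_apply, hp, prod_sum_eq_sum_prod]
  rw [← g.sum_comp]
  refine Finset.sum_congr rfl fun f _ => ?_
  rw [← g.sum_comp]
  refine Finset.sum_congr rfl fun f' _ => ?_
  rw [Finset.prod_mul_distrib]
  rfl

lemma repeated_law (hN : ∀ s, IsChannel (N s)) (hφ : IsDensity φ) (hθ : IsDist θ) :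
    (S.repeated e).law θ = prodLaw K (S.law θ) := by
  funext x y
  have hd := fun z x => prodOp_isDensity fun t => S.avg_isDensity θ hN hφ hθ t z x
  simp only [prodLaw, law, prod_sum_eq_sum_prod]
  refine Finset.sum_congr rfl fun z _ => ?_
  rw [Finset.prod_mul_distrib]
  refine congrArg (fun c : ℝ => prodDist K S.p z * c) ?_
  -- The real part of the product is the product of the real parts only because each trace is real.
  rw [trace_repeated_povm_mul, Finset.prod_congr rfl fun k _ =>
    (ofReal_trace_mul_re ((S.povm_povm (z k)).1 (y k)) (hd (z k) (x k)).1).symm,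
    ← Complex.ofReal_prod, Complex.ofReal_re]

lemma repeated_detect (t : Fin T') (s r : Fin 2) :
    (S.repeated e).detect t s r = S.detect (e t).2 s r := by
  simp only [detect, repeated]
  rw [sum_prodDist_mul S.q_dist.2 (fun x => ∑ z : K → Z, prodDist K S.p z *
    (S.F (e t).2 (z (e t).1) x s r).trace.re)]
  refine Finset.sum_congr rfl fun x _ => ?_
  rw [sum_prodDist_mul S.p_dist.2 (fun z => (S.F (e t).2 z x s r).trace.re)]

end Repeated

end Scheme

end Schemes

/-! ### The mutual information region and its convexity -/

section InfoRegion

variable {I J A B : Type} [Fintype I] [DecidableEq I] [Fintype J] [DecidableEq J]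
  [Fintype A] [DecidableEq A] [Fintype B] [DecidableEq B]

/-- The pairs `(R, Pe)` such that some scheme has mutual information per slot `R`, up to an
arbitrarily small loss, and detection error at most `Pe`. -/
def infoRegion (N : Fin 2 → Matrix I I ℂ →ₗ[ℂ] Matrix J J ℂ) (φ : Matrix (A × B) (A × B) ℂ)
    (θ π : Fin 2 → ℝ) : Set (ℝ × ℝ) :=
  {x | ∀ ε : ℝ, 0 < ε →
    ∃ (X Y Z Q : Type) (_ : Fintype X) (_ : Fintype Y) (_ : Fintype Z) (_ : Fintype Q)
      (_ : DecidableEq Q) (T : ℕ) (S : Scheme N φ T X Y Z Q),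
      0 < T ∧ Nonempty Q ∧ T * (x.1 - ε) ≤ mutualInfo S.q (S.law θ) ∧
        ∀ t, S.detectErr π t ≤ x.2}

lemma infoRegion_convex {N : Fin 2 → Matrix I I ℂ →ₗ[ℂ] Matrix J J ℂ}
    {φ : Matrix (A × B) (A × B) ℂ} {θ : Fin 2 → ℝ} (π : Fin 2 → ℝ) (hN : ∀ s, IsChannel (N s))
    (hφ : IsDensity φ) (hθ : IsDist θ) : Convex ℝ (infoRegion N φ θ π) := by
  intro x hx x' hx' a b ha hb hab ε hε
  obtain ⟨X, Y, Z, Q, _, _, _, _, _, T, S, hT, ⟨e₀⟩, hI, hd⟩ := hx ε hε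
  obtain ⟨X', Y', Z', Q', _, _, _, _, _, T', S', hT', ⟨e₀'⟩, hI', hd'⟩ := hx' ε hε
  -- T' copies of the first scheme and T copies of the second both fill T * T' slots. Each is
  -- widened by an idle copy of the other's residual system.
  let R := (S.repeated (K := Fin T') (finProdFinEquiv.symm.trans (Equiv.prodComm _ _) :
    Fin (T * T') ≃ Fin T' × Fin T)).widen (Equiv.refl (Q × Q')) e₀'
  let R' := (S'.repeated (K := Fin T) (finProdFinEquiv.symm : Fin (T * T') ≃ Fin T × Fin T')).widen
    (Equiv.prodComm Q Q') e₀
  refine ⟨_, _, _, _, inferInstance, inferInstance, inferInstance, inferInstance, inferInstance, _,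
    R.mix R' ha hb hab, Nat.mul_pos hT hT', ⟨(e₀, e₀')⟩, ?_, fun t => ?_⟩
  · have h1 : R.law θ = prodLaw (Fin T') (S.law θ) := by
      funext x y
      exact (Scheme.widen_law _ θ _ _ x y).trans
        (congrFun (congrFun (S.repeated_law θ _ hN hφ hθ) x) y)
    have h2 : R'.law θ = prodLaw (Fin T) (S'.law θ) := by
      funext x y
      exact (Scheme.widen_law _ θ _ _ x y).trans
        (congrFun (congrFun (S'.repeated_law θ _ hN hφ hθ) x) y)
    have h3 : (R.mix R' ha hb hab).law θ = fun x => Sum.elim (fun y => a * R.law θ x.1 y)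
        fun y => b * R'.law θ x.2 y := funext fun x => Scheme.mix_law R θ R' ha hb hab x
    rw [h3, show (R.mix R' ha hb hab).q = fun x => R.q x.1 * R'.q x.2 from rfl,
      mutualInfo_mix R.q_dist R'.q_dist, h1, h2]
    have h4 := mutualInfo_prod (K := Fin T') S.q_dist (S.law_isDist θ hN hφ hθ)
    have h5 := mutualInfo_prod (K := Fin T) S'.q_dist (S'.law_isDist θ hN hφ hθ)
    change _ ≤ a * mutualInfo (prodDist (Fin T') S.q) _ + b * mutualInfo (prodDist (Fin T) S'.q) _
    rw [h4, h5, Fintype.card_fin, Fintype.card_fin]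
    have h6 := mul_le_mul_of_nonneg_left hI (mul_nonneg ha (Nat.cast_nonneg (α := ℝ) T'))
    have h7 := mul_le_mul_of_nonneg_left hI' (mul_nonneg hb (Nat.cast_nonneg (α := ℝ) T))
    have e : (a • x + b • x').1 - ε = a * (x.1 - ε) + b * (x'.1 - ε) := by
      simp only [Prod.fst_add, Prod.smul_fst, smul_eq_mul]
      linear_combination (-ε) * hab.symm
    rw [e]
    push_cast
    linarith
  · simp only [Scheme.detectErr, Scheme.mix_detect, R, R', Scheme.widen_detect,
      Scheme.repeated_detect, Prod.snd_add, Prod.smul_snd, smul_eq_mul]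
    have h1 := mul_le_mul_of_nonneg_left
      (hd ((finProdFinEquiv.symm.trans (Equiv.prodComm _ _)) t).2) ha
    have h2 := mul_le_mul_of_nonneg_left (hd' (finProdFinEquiv.symm t).2) hb
    simp only [Scheme.detectErr] at h1 h2
    linarith

end InfoRegion

/-! ### Protocols whose initial state is a mixture of product states -/

section ProductStates

lemma prodOp_kronecker {I K : Type} {T : ℕ} (X : Fin T → Matrix I I ℂ) (Y : Fin T → Matrix K K ℂ) :
    prodOp (fun t => X t ⊗ₖ Y t) = (prodOp X ⊗ₖ prodOp Y).submatrix
      (Equiv.arrowProdEquivProdArrow (Fin T) (fun _ => I) fun _ => K)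
      (Equiv.arrowProdEquivProdArrow (Fin T) (fun _ => I) fun _ => K) := by
  ext f f'
  simp only [prodOp, Matrix.submatrix_apply, Matrix.kroneckerMap_apply, Finset.prod_mul_distrib]
  rfl

lemma prodOp_single {I : Type} [DecidableEq I] {T : ℕ} (i : Fin T → I) :
    prodOp (fun t => Matrix.single (i t) (i t) (1 : ℂ)) = Matrix.single i i 1 := by
  ext f f'
  simp only [prodOp, Matrix.single_apply, Finset.prod_ite_zero, Finset.prod_const_one,
    Finset.mem_univ, true_imp_iff, forall_and, funext_iff]

namespace Protocol

variable {I J A B Q ι : Type} [Fintype I] [DecidableEq I] [Fintype J] [DecidableEq J]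
  [Fintype A] [DecidableEq A] [Fintype B] [DecidableEq B] [Fintype Q] [DecidableEq Q] [Fintype ι]
  {M T : ℕ} (P : Protocol I J A B Q M T)
  (N : Fin 2 → Matrix I I ℂ →ₗ[ℂ] Matrix J J ℂ) (θ : Fin 2 → ℝ)

/-- The state in front of the detector in slot `t`, for message `w` and channel state `s`, if the
initial state in this slot is `X`. -/
def slotState (X : Matrix (A × B) (A × B) ℂ) (w : Fin M) (t : Fin T) (s : Fin 2) :
    Matrix (J × B) (J × B) ℂ :=
  onLeft B (N s) (onLeft B (P.enc t w) X)

variable {P} {c : ι → ℝ} {X : ι → Fin T → Matrix (A × B) (A × B) ℂ}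
  (hρ : P.ρ = ∑ i, (c i : ℂ) • prodOp (X i))

include hρ in
lemma received_eq (w : Fin M) (s : Fin T → Fin 2) :
    P.received N w s = ∑ i, (c i : ℂ) • prodOp fun t => P.slotState N (X i t) w t (s t) := by
  simp only [received, encoded, hρ, tensorMap_sum, tensorMap_prodOp, slotState]

include hρ in
lemma receivedAvg_eq (w : Fin M) :
    P.receivedAvg N θ w = ∑ i, (c i : ℂ) • prodOp fun t =>
      ∑ s, (θ s : ℂ) • P.slotState N (X i t) w t s := by
  simp only [receivedAvg, received_eq N hρ, prodOp_sum, prodOp_smul, Finset.smul_sum]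
  rw [Finset.sum_comm]
  refine Finset.sum_congr rfl fun i _ => Finset.sum_congr rfl fun s _ => ?_
  rw [smul_comm, Complex.ofReal_prod]

include hρ in
lemma measured_eq (w : Fin M) :
    P.measured N θ w = ∑ i, (c i : ℂ) • ∑ r : Fin T → Fin 2, Matrix.single r r (1 : ℂ) ⊗ₖ
      prodOp fun t => ∑ s, (θ s : ℂ) • P.instr (r t) (P.slotState N (X i t) w t s) := by
  simp only [measured, receivedAvg_eq N θ hρ, tensorMap_sum, tensorMap_prodOp, map_sum, map_smul,
    Finset.smul_sum]
  rw [Finset.sum_comm]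
  refine Finset.sum_congr rfl fun r _ => ?_
  ext p q
  simp only [Matrix.kroneckerMap_apply, Matrix.sum_apply, Matrix.smul_apply, Finset.mul_sum,
    smul_eq_mul, mul_left_comm]

include hρ in
lemma decodeProb_eq (w v : Fin M) :
    P.decodeProb N θ w v = ∑ i, c i * (P.dec v * ∑ r : Fin T → Fin 2,
      Matrix.single r r (1 : ℂ) ⊗ₖ prodOp fun t =>
        ∑ s, (θ s : ℂ) • P.instr (r t) (P.slotState N (X i t) w t s)).trace.re := by
  simp only [decodeProb, measured_eq N θ hρ]
  rw [Finset.mul_sum, Matrix.trace_sum, Complex.re_sum]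
  refine Finset.sum_congr rfl fun i _ => ?_
  rw [Matrix.mul_smul, Matrix.trace_smul, smul_eq_mul, Complex.re_ofReal_mul]

lemma sum_ite_prod_erase {θ : Fin 2 → ℝ} (hθ : ∑ s, θ s = 1) (t : Fin T) (s : Fin 2) :
    ∑ r : Fin T → Fin 2, (if r t = s then ∏ t' ∈ Finset.univ.erase t, θ (r t') else 0) = 1 := by
  have h : ∀ r : Fin T → Fin 2, (if r t = s then ∏ t' ∈ Finset.univ.erase t, θ (r t') else 0)
      = ∏ t', if t' = t then (if r t' = s then 1 else 0) else θ (r t') := by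
    intro r
    rw [← Finset.mul_prod_erase _ _ (Finset.mem_univ t), if_pos rfl, ite_mul, one_mul, zero_mul]
    refine if_congr Iff.rfl (Finset.prod_congr rfl fun t' ht' => ?_) rfl
    rw [if_neg (Finset.ne_of_mem_erase ht')]
  simp only [h]
  rw [← prod_sum_eq_sum_prod (fun t' r => if t' = t then (if r = s then 1 else 0) else θ r)]
  refine Finset.prod_eq_one fun t' _ => ?_
  split_ifs
  · simp
  · exact hθ

include hρ in
-- The state of every other slot has trace one, so the partial trace leaves slot t alone, and the
-- channel states elsewhere average out.
lemma detectProb_eq (hN : ∀ s, IsChannel (N s)) (hθ : ∑ s, θ s = 1)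
    (hX : ∀ i t, IsDensity (X i t)) (t : Fin T) (s r : Fin 2) :
    P.detectProb N θ t s r = ∑ w : Fin M, 1 / (M : ℝ) * ∑ i, c i *
      (P.instr r (P.slotState N (X i t) w t s)).trace.re := by
  have htr : ∀ i w t s, (P.slotState N (X i t) w t s).trace = 1 := fun i w t s =>
    ((hN s).isDensity_onLeft ((P.enc_channel t w).isDensity_onLeft (hX i t))).2
  have hred : ∀ w r', reduced t (P.received N w r')
      = ∑ i, (c i : ℂ) • P.slotState N (X i t) w t (r' t) := by
    intro w r'
    rw [received_eq N hρ, reduced_sum]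
    simp only [reduced_prodOp, htr, Finset.prod_const_one, one_smul]
  have h : reduced t (P.receivedGiven N θ t s)
      = ∑ w : Fin M, ((1 / M : ℝ) : ℂ) • ∑ i, (c i : ℂ) • P.slotState N (X i t) w t s := by
    -- The condition on the channel state is moved into the coefficient, so that `reduced_sum`
    -- applies to a plain linear combination.
    have e : P.receivedGiven N θ t s = ∑ p : Fin M × (Fin T → Fin 2),
        (((1 / M : ℝ) * (if p.2 t = s then ∏ t' ∈ Finset.univ.erase t, θ (p.2 t') else 0) : ℝ) : ℂ)
          • P.received N p.1 p.2 := by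
      rw [receivedGiven, Fintype.sum_prod_type]
      refine Finset.sum_congr rfl fun w _ => Finset.sum_congr rfl fun r' _ => ?_
      split_ifs
      · rfl
      · simp
    rw [e, reduced_sum, Fintype.sum_prod_type]
    refine Finset.sum_congr rfl fun w _ => ?_
    have e2 : ∀ r' : Fin T → Fin 2, (((1 / M : ℝ) *
        (if r' t = s then ∏ t' ∈ Finset.univ.erase t, θ (r' t') else 0) : ℝ) : ℂ) •
          reduced t (P.received N w r') = (((1 / M : ℝ) *
        (if r' t = s then ∏ t' ∈ Finset.univ.erase t, θ (r' t') else 0) : ℝ) : ℂ) •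
          ∑ i, (c i : ℂ) • P.slotState N (X i t) w t s := by
      intro r'
      by_cases hr : r' t = s
      · rw [hred, hr]
      · simp [hr]
    simp only [e2]
    rw [← Finset.sum_smul, ← Complex.ofReal_sum, ← Finset.mul_sum, sum_ite_prod_erase hθ, mul_one]
  rw [detectProb, h]
  simp only [map_sum, map_smul, Matrix.trace_sum, Complex.re_sum, Matrix.trace_smul, smul_eq_mul,
    Complex.re_ofReal_mul]

end Protocol

end ProductStates

/-! ### Encoders and instruments selected by a classical register -/

section Controlled

variable {I J A B Q R : Type} [Fintype I] [DecidableEq I] [Fintype J] [DecidableEq J]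
  [Fintype A] [DecidableEq A] [Fintype B] [DecidableEq B] [Fintype Q] [DecidableEq Q]
  [Fintype R] [DecidableEq R]

/-- The state `φ` together with the value `k` in a classical register on either side. -/
def controlledState (φ : Matrix (A × B) (A × B) ℂ) (k : R) :
    Matrix ((A × R) × (B × R)) ((A × R) × (B × R)) ℂ :=
  (φ ⊗ₖ Matrix.single (k, k) (k, k) 1).submatrix (fun f => ((f.1.1, f.2.1), (f.1.2, f.2.2)))
    (fun f => ((f.1.1, f.2.1), (f.1.2, f.2.2)))

/-- The state `ψ` together with the value `k` in a classical register on the right. -/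
def rightControlledState (ψ : Matrix (I × B) (I × B) ℂ) (k : R) :
    Matrix (I × (B × R)) (I × (B × R)) ℂ :=
  (ψ ⊗ₖ Matrix.single k k 1).submatrix (fun f => ((f.1, f.2.1), f.2.2))
    (fun f => ((f.1, f.2.1), f.2.2))

/-- The encoder that is selected by a classical register. -/
def controlledEnc (enc : R → Matrix A A ℂ →ₗ[ℂ] Matrix I I ℂ) :
    Matrix (A × R) (A × R) ℂ →ₗ[ℂ] Matrix I I ℂ :=
  ∑ k, enc k ∘ₗ submatrixMap fun a => (a, k)

/-- The instrument that is selected by a classical register, which is kept. -/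
def controlledInstr (instr : R → Fin 2 → Matrix (J × B) (J × B) ℂ →ₗ[ℂ] Matrix Q Q ℂ) (r : Fin 2) :
    Matrix (J × (B × R)) (J × (B × R)) ℂ →ₗ[ℂ] Matrix (Q × R) (Q × R) ℂ :=
  ∑ k, appendMap (Matrix.single k k 1) ∘ₗ instr k r ∘ₗ submatrixMap fun p => (p.1, (p.2, k))

lemma controlledState_isDensity {φ : Matrix (A × B) (A × B) ℂ} (hφ : IsDensity φ) (k : R) :
    IsDensity (controlledState φ k) :=
  ⟨(hφ.prod (isDensity_single (k, k))).1.submatrix _,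
    (trace_submatrix_equiv (Equiv.prodProdProdComm A R B R)
      (φ ⊗ₖ Matrix.single (k, k) (k, k) (1 : ℂ))).trans (hφ.prod (isDensity_single (k, k))).2⟩

lemma controlledEnc_isChannel {enc : R → Matrix A A ℂ →ₗ[ℂ] Matrix I I ℂ}
    (h : ∀ k, IsChannel (enc k)) : IsChannel (controlledEnc enc) := by
  refine ⟨IsCP.sum _ fun k _ => (h k).1.comp (isCP_submatrixMap _), fun X => ?_⟩
  simp only [controlledEnc, LinearMap.sum_apply, LinearMap.comp_apply, Matrix.trace_sum, (h _).2]
  simp [Matrix.trace, Fintype.sum_prod_type_right]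

lemma controlledInstr_isInstrument
    {instr : R → Fin 2 → Matrix (J × B) (J × B) ℂ →ₗ[ℂ] Matrix Q Q ℂ}
    (h : ∀ k, IsInstrument (instr k)) : IsInstrument (controlledInstr instr) := by
  refine ⟨fun r => IsCP.sum _ fun k _ => (isCP_appendMap (isDensity_single k).1).comp
    (((h k).1 r).comp (isCP_submatrixMap _)), fun X => ?_⟩
  simp only [controlledInstr, LinearMap.sum_apply, LinearMap.comp_apply, appendMap_apply]
  rw [Finset.sum_comm]
  have : ∀ k, (∑ r, instr k r (submatrixMap (fun p : J × B => (p.1, (p.2, k))) X) ⊗ₖ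
      Matrix.single k k (1 : ℂ)).trace = ∑ j, ∑ b, X (j, (b, k)) (j, (b, k)) := by
    intro k
    simp only [Matrix.trace_sum, Matrix.trace_kronecker, (isDensity_single k).2, mul_one]
    rw [← Matrix.trace_sum, (h k).2]
    simp [Matrix.trace, Fintype.sum_prod_type]
  rw [Matrix.trace_sum, Finset.sum_congr rfl fun k _ => this k, Finset.sum_comm]
  simp only [Matrix.trace, Matrix.diag_apply, Fintype.sum_prod_type]
  exact Finset.sum_congr rfl fun j _ => Finset.sum_comm

/-- Only the summand matching the register survives; the sender's copy of k is consumed and the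
receiver's copy remains. -/
lemma onLeft_controlledEnc (enc : R → Matrix A A ℂ →ₗ[ℂ] Matrix I I ℂ)
    (φ : Matrix (A × B) (A × B) ℂ) (k : R) :
    onLeft (B × R) (controlledEnc enc) (controlledState φ k)
      = rightControlledState (onLeft B (enc k) φ) k := by
  ext ⟨i, b, l⟩ ⟨i', b', l'⟩
  simp only [onLeft_apply, controlledEnc, LinearMap.sum_apply, Matrix.sum_apply,
    LinearMap.comp_apply, submatrixMap_apply, rightControlledState, Matrix.submatrix_apply,
    Matrix.kroneckerMap_apply]
  have : ∀ m, (((controlledState φ k).submatrix (fun a => (a, (b, l))) fun a => (a, (b', l'))).submatrix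
      (fun a : A => (a, m)) fun a => (a, m)) = (Matrix.single (k, k) (k, k) (1 : ℂ) (m, l) (m, l')) •
        φ.submatrix (fun a => (a, b)) fun a => (a, b') := by
    intro m
    ext a a'
    simp [controlledState, mul_comm]
  simp only [this, map_smul, Matrix.smul_apply, smul_eq_mul]
  rw [Finset.sum_eq_single k (fun m _ hm => by simp [hm.symm]) (by simp)]
  simp [Matrix.single_apply, mul_comm]

lemma onLeft_rightControlledState (Φ : Matrix I I ℂ →ₗ[ℂ] Matrix J J ℂ)
    (ψ : Matrix (I × B) (I × B) ℂ) (k : R) :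
    onLeft (B × R) Φ (rightControlledState ψ k) = rightControlledState (onLeft B Φ ψ) k := by
  ext ⟨i, b, l⟩ ⟨i', b', l'⟩
  simp only [onLeft_apply, rightControlledState, Matrix.submatrix_apply, Matrix.kroneckerMap_apply]
  have : ((rightControlledState ψ k).submatrix (fun a => (a, (b, l))) fun a => (a, (b', l')))
      = (Matrix.single k k (1 : ℂ) l l') • ψ.submatrix (fun a => (a, b)) fun a => (a, b') := by
    ext a a'
    simp [rightControlledState, mul_comm]
  rw [rightControlledState] at this
  rw [this, map_smul, Matrix.smul_apply, smul_eq_mul, mul_comm]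

lemma controlledInstr_apply (instr : R → Fin 2 → Matrix (J × B) (J × B) ℂ →ₗ[ℂ] Matrix Q Q ℂ)
    (r : Fin 2) (ψ : Matrix (J × B) (J × B) ℂ) (k : R) :
    controlledInstr instr r (rightControlledState ψ k) = instr k r ψ ⊗ₖ Matrix.single k k 1 := by
  simp only [controlledInstr, LinearMap.sum_apply, LinearMap.comp_apply, submatrixMap_apply,
    appendMap_apply]
  have : ∀ m, (rightControlledState ψ k).submatrix (fun p : J × B => (p.1, (p.2, m)))
      (fun p => (p.1, (p.2, m))) = Matrix.single k k (1 : ℂ) m m • ψ := by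
    intro m
    ext p p'
    simp [rightControlledState, mul_comm]
  simp only [this, map_smul]
  rw [Finset.sum_eq_single k (fun m _ hm => by simp [hm.symm]) (by simp)]
  simp

/-- The common randomness has the law of `h i` for i drawn from c, so one hidden index i can
determine the registers of all slots at once. -/
lemma withCommonRandomness_eq {T : ℕ} {ι : Type} [Fintype ι] (c : ι → ℝ) (h : ι → Fin T → R)
    (φ : Fin T → Matrix (A × B) (A × B) ℂ) :
    withCommonRandomness (fun z => ∑ i, if h i = z then c i else 0) (prodOp φ)
      = ∑ i, (c i : ℂ) • prodOp fun t => controlledState (φ t) (h i t) := by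
  ext f f'
  simp only [withCommonRandomness, Complex.ofReal_sum, Finset.sum_mul, Matrix.sum_apply,
    Matrix.smul_apply, smul_eq_mul]
  rw [Finset.sum_comm]
  refine Finset.sum_congr rfl fun i _ => ?_
  rw [Finset.sum_eq_single (h i) (fun z _ hz => by simp [hz.symm]) (by simp), if_pos rfl]
  simp only [prodOp, ← Finset.prod_mul_distrib]
  congr 1
  refine Finset.prod_congr rfl fun t _ => ?_
  simp only [controlledState, Matrix.submatrix_apply, Matrix.kroneckerMap_apply,
    Matrix.single_apply, Prod.ext_iff, ← ite_and, mul_ite, mul_one, mul_zero]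
  refine if_congr ?_ rfl rfl
  tauto

lemma sum_controlledState_isDensity {T : ℕ} {ι : Type} [Fintype ι] {c : ι → ℝ} (hc : IsDist c)
    {φ : Matrix (A × B) (A × B) ℂ} (hφ : IsDensity φ) (h : ι → Fin T → R) :
    IsDensity (∑ i, (c i : ℂ) • prodOp fun t => controlledState φ (h i t)) := by
  have hd := fun i => prodOp_isDensity fun t => controlledState_isDensity hφ (h i t)
  refine ⟨Matrix.posSemidef_sum _ fun i _ => (hd i).1.smul (by exact_mod_cast hc.1 i), ?_⟩
  simp only [Matrix.trace_sum, Matrix.trace_smul, (hd _).2, smul_eq_mul, mul_one]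
  exact_mod_cast hc.2

end Controlled

/-! ### Block measurements selected by a classical register -/

section RegisterMeasurement

variable {Q R : Type} [Fintype Q] [DecidableEq Q] [Fintype R] [DecidableEq R] {T : ℕ}

/-- The rearrangement of detection results, quantum systems and classical registers. -/
def registerEquiv (T : ℕ) (Q R : Type) : ((Fin T → Fin 2) × (Fin T → Q × R)) ≃
    (Fin T → Q) × ((Fin T → Fin 2) × (Fin T → R)) where
  toFun x := (fun t => (x.2 t).1, (x.1, fun t => (x.2 t).2))
  invFun y := (y.2.1, fun t => (y.1 t, y.2.2 t))
  left_inv _ := rfl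
  right_inv _ := rfl

/-- Measure `D k` on the quantum systems if `k` is the content of the registers of slot `t₀`. -/
def registerMeas (t₀ : Fin T) (D : R → Matrix (Fin T → Q) (Fin T → Q) ℂ) :
    Matrix ((Fin T → Fin 2) × (Fin T → Q × R)) ((Fin T → Fin 2) × (Fin T → Q × R)) ℂ :=
  (∑ k : (Fin T → Fin 2) × (Fin T → R), D (k.2 t₀) ⊗ₖ Matrix.single k k (1 : ℂ)).submatrix
    (registerEquiv T Q R) (registerEquiv T Q R)

lemma sum_single_self {K : Type} [Fintype K] [DecidableEq K] :
    ∑ k : K, Matrix.single k k (1 : ℂ) = 1 := by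
  ext i j
  simp only [Matrix.sum_apply, Matrix.single_apply, Matrix.one_apply, ite_and]
  simp

lemma registerMeas_isPOVM {V : Type} [Fintype V] (t₀ : Fin T)
    {D : V → R → Matrix (Fin T → Q) (Fin T → Q) ℂ} (h : ∀ k, IsPOVM fun v => D v k) :
    IsPOVM fun v => registerMeas t₀ (D v) := by
  refine ⟨fun v => (Matrix.posSemidef_sum _ fun k _ =>
    ((h _).1 v).kronecker (isDensity_single k).1).submatrix _, ?_⟩
  have e : ∑ v, registerMeas t₀ (D v) = (∑ k : (Fin T → Fin 2) × (Fin T → R),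
      (∑ v, D v (k.2 t₀)) ⊗ₖ Matrix.single k k (1 : ℂ)).submatrix
        (registerEquiv T Q R) (registerEquiv T Q R) := by
    ext f f'
    simp only [registerMeas, Matrix.sum_apply, Matrix.submatrix_apply, Matrix.kroneckerMap_apply,
      Finset.sum_mul]
    exact Finset.sum_comm
  have e2 : ∑ k : (Fin T → Fin 2) × (Fin T → R),
      (1 : Matrix (Fin T → Q) (Fin T → Q) ℂ) ⊗ₖ Matrix.single k k (1 : ℂ) = 1 := by
    rw [← Matrix.one_kronecker_one, ← sum_single_self (K := (Fin T → Fin 2) × (Fin T → R))]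
    ext f f'
    simp only [Matrix.sum_apply, Matrix.kroneckerMap_apply, Finset.mul_sum]
  simp only [e, (h _).2]
  rw [e2, Matrix.submatrix_one_equiv]

/-- The measurement depends on the registers but not on the detection results, which are therefore
summed over in each slot. -/
lemma trace_registerMeas_mul (t₀ : Fin T) (D : R → Matrix (Fin T → Q) (Fin T → Q) ℂ)
    (τ : Fin T → Fin 2 → Matrix Q Q ℂ) (k : Fin T → R) :
    (registerMeas t₀ D * ∑ r : Fin T → Fin 2, Matrix.single r r (1 : ℂ) ⊗ₖ
      prodOp fun t => τ t (r t) ⊗ₖ Matrix.single (k t) (k t) (1 : ℂ)).trace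
      = (D (k t₀) * prodOp fun t => ∑ r, τ t r).trace := by
  have h : ∀ r : Fin T → Fin 2, Matrix.single r r (1 : ℂ) ⊗ₖ
      (prodOp fun t => τ t (r t) ⊗ₖ Matrix.single (k t) (k t) (1 : ℂ))
      = ((prodOp fun t => τ t (r t)) ⊗ₖ Matrix.single (r, k) (r, k) (1 : ℂ)).submatrix
        (registerEquiv T Q R) (registerEquiv T Q R) := by
    intro r
    rw [prodOp_kronecker, prodOp_single]
    ext ⟨f, f2⟩ ⟨f', f2'⟩
    simp only [Matrix.submatrix_apply, Matrix.kroneckerMap_apply, registerEquiv, Equiv.coe_fn_mk,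
      Matrix.single_apply, Prod.ext_iff]
    change _ * (_ * if (k = fun t => (f2 t).2) ∧ (k = fun t => (f2' t).2) then 1 else 0) = _
    simp only [← ite_and, mul_ite, mul_one, mul_zero, ite_mul, one_mul, zero_mul]
    refine if_congr ?_ rfl rfl
    tauto
  rw [prodOp_sum, Finset.mul_sum, Finset.mul_sum, Matrix.trace_sum, Matrix.trace_sum]
  refine Finset.sum_congr rfl fun r _ => ?_
  rw [h, registerMeas, Matrix.submatrix_mul_equiv, trace_submatrix_equiv, Finset.sum_mul,
    Matrix.trace_sum, Finset.sum_eq_single (r, k)]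
  · rw [← Matrix.mul_kronecker_mul, Matrix.trace_kronecker]
    simp
  · intro l _ hl
    rw [← Matrix.mul_kronecker_mul, Matrix.trace_kronecker, Matrix.single_mul_single_of_ne _ _ _ _ hl]
    simp
  · simp

end RegisterMeasurement

/-! ### From schemes to protocols by a shared random codebook -/

section Coding

variable {I J A B : Type} [Fintype I] [DecidableEq I] [Fintype J] [DecidableEq J]
  [Fintype A] [DecidableEq A] [Fintype B] [DecidableEq B]
  {N : Fin 2 → Matrix I I ℂ →ₗ[ℂ] Matrix J J ℂ} {ψ : Matrix (A × B) (A × B) ℂ}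

/-- A random codebook turns a scheme into a protocol; the codebook is part of the common
randomness. -/
lemma Scheme.exists_protocol {a b : ℝ} {T : ℕ} {X Y Z Q : Type} [Fintype X] [DecidableEq X]
    [Fintype Y] [Fintype Z] [DecidableEq Z] [Fintype Q] [DecidableEq Q]
    {φ : Matrix (A × B) (A × B) ℂ} (S : Scheme N φ T X Y Z Q) (hT : 0 < T)
    (hψ : IsDensity ψ) (hφψ : onRight A (depolarizing B a b) ψ = φ) (hφ : IsDensity φ)
    (hN : ∀ s, IsChannel (N s)) {θ : Fin 2 → ℝ} (hθ : IsDist θ) {M : ℕ} (hM : 0 < M)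
    (g : (Fin M → X) → Y → Fin M) :
    ∃ P : Protocol I J (A × (Fin T × ((Fin M → X) × Z))) (B × (Fin T × ((Fin M → X) × Z)))
        (Q × (Fin T × ((Fin M → X) × Z))) M T,
      IsUnreliable a b P.ρ ∧
      (∀ w v, P.decodeProb N θ w v =
        ∑ C, prodDist (Fin M) S.q C * ∑ y, if g C y = v then S.law θ (C w) y else 0) ∧
      ∀ t s r, P.detectProb N θ t s r = S.detect t s r := by
  choose enc instr henc hinstr hF using S.device
  set c : (Fin M → X) × Z → ℝ := fun i => prodDist (Fin M) S.q i.1 * S.p i.2 with hc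
  have hcdist : IsDist c := ⟨fun i => mul_nonneg (S.q_dist.prodDist.1 _) (S.p_dist.1 _), by
    simp [hc, Fintype.sum_prod_type, ← Finset.mul_sum, S.p_dist.2, S.q_dist.prodDist.2]⟩
  -- The register of slot t holds t itself next to the codebook and the block randomness: a protocol
  -- has a single instrument for all slots, and the tag lets it act as the instrument of slot t.
  set p : (Fin T → Fin T × ((Fin M → X) × Z)) → ℝ :=
    fun z => ∑ i, if (fun t => (t, i)) = z then c i else 0 with hp
  have hρ : withCommonRandomness p (tensorMap (fun _ => onRight A (depolarizing B a b))
      (prodOp fun _ => ψ)) = ∑ i, (c i : ℂ) • prodOp fun t => controlledState φ (t, i) := by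
    rw [tensorMap_prodOp, hp, withCommonRandomness_eq, hφψ]
  -- The block measurement, followed by the decoder `g` for the codebook found in the register.
  let D : Fin M → Fin T × ((Fin M → X) × Z) → Matrix (Fin T → Q) (Fin T → Q) ℂ :=
    fun v k => ∑ y, if g k.2.1 y = v then S.povm k.2.2 y else 0
  have hD : ∀ k, IsPOVM fun v => D v k := by
    refine fun k => ⟨fun v => Matrix.posSemidef_sum _ fun y _ => ?_, ?_⟩
    · split_ifs
      exacts [(S.povm_povm _).1 y, Matrix.PosSemidef.zero]
    · simp only [D]
      rw [Finset.sum_comm]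
      simp [(S.povm_povm _).2]
  let P : Protocol I J (A × (Fin T × ((Fin M → X) × Z))) (B × (Fin T × ((Fin M → X) × Z)))
      (Q × (Fin T × ((Fin M → X) × Z))) M T :=
    { ρ := withCommonRandomness p (tensorMap (fun _ => onRight A (depolarizing B a b))
        (prodOp fun _ => ψ))
      ρ_density := hρ ▸ sum_controlledState_isDensity hcdist hφ fun i t => (t, i)
      enc := fun _ w => controlledEnc fun k => enc k.1 k.2.2 (k.2.1 w)
      enc_channel := fun _ w => controlledEnc_isChannel fun k => henc _ _ _
      instr := controlledInstr fun k => instr k.1 k.2.2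
      instr_instrument := controlledInstr_isInstrument fun k => hinstr _ _
      -- All slots carry the same codebook and block randomness, so reading slot 0 suffices.
      dec := fun v => registerMeas ⟨0, hT⟩ (D v)
      dec_povm := registerMeas_isPOVM _ hD }
  have hPρ : P.ρ = ∑ i, (c i : ℂ) • prodOp fun t => controlledState φ (t, i) := hρ
  have hout : ∀ i w t s r, P.instr r (P.slotState N (controlledState φ (t, i)) w t s)
      = S.F t i.2 (i.1 w) s r ⊗ₖ Matrix.single (t, i) (t, i) 1 := by
    intro i w t s r
    rw [hF]
    simp only [Protocol.slotState, P]
    rw [onLeft_controlledEnc, onLeft_rightControlledState, controlledInstr_apply]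
  refine ⟨P, ⟨p, prodOp fun _ => ψ, fun z => Finset.sum_nonneg fun i _ => ?_, ?_,
    prodOp_isDensity fun _ => hψ, rfl⟩, fun w v => ?_, fun t s r => ?_⟩
  · split_ifs
    exacts [hcdist.1 i, le_rfl]
  · rw [hp, Finset.sum_comm]
    simpa using hcdist.2
  · rw [Protocol.decodeProb_eq N θ hPρ]
    have hi : ∀ i, (P.dec v * ∑ r : Fin T → Fin 2, Matrix.single r r (1 : ℂ) ⊗ₖ prodOp fun t =>
        ∑ s, (θ s : ℂ) • P.instr (r t) (P.slotState N (controlledState φ (t, i)) w t s)).trace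
        = ∑ y, if g i.1 y = v then
          (S.povm i.2 y * prodOp fun t => S.avg θ t i.2 (i.1 w)).trace else 0 := by
      intro i
      have h1 : ∀ t r, ∑ s, (θ s : ℂ) • P.instr r (P.slotState N (controlledState φ (t, i)) w t s)
          = (∑ s, (θ s : ℂ) • S.F t i.2 (i.1 w) s r) ⊗ₖ Matrix.single (t, i) (t, i) 1 := by
        intro t r
        simp only [hout, ← appendMap_apply, map_sum, map_smul]
      simp only [h1]
      change (registerMeas ⟨0, hT⟩ (D v) * _).trace = _
      rw [trace_registerMeas_mul ⟨0, hT⟩ (D v)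
        (fun t r => ∑ s, (θ s : ℂ) • S.F t i.2 (i.1 w) s r) fun t => (t, i)]
      have h2 : ∀ t, ∑ r, ∑ s, (θ s : ℂ) • S.F t i.2 (i.1 w) s r = S.avg θ t i.2 (i.1 w) := by
        intro t
        rw [Finset.sum_comm]
        simp only [← Finset.smul_sum, Scheme.avg]
      simp only [h2, D, Finset.sum_mul, Matrix.trace_sum]
      refine Finset.sum_congr rfl fun y _ => ?_
      split_ifs <;> simp
    simp only [hi, Complex.re_sum]
    rw [Fintype.sum_prod_type]
    refine Finset.sum_congr rfl fun C _ => ?_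
    simp only [hc, mul_assoc, ← Finset.mul_sum]
    congr 1
    simp only [Finset.mul_sum]
    rw [Finset.sum_comm]
    refine Finset.sum_congr rfl fun y _ => ?_
    split_ifs
    · rfl
    · simp
  · rw [Protocol.detectProb_eq N θ hPρ hN hθ.2 fun i t => controlledState_isDensity hφ (t, i)]
    -- Each codeword of the random codebook has distribution `S.q`, so the value is the same for
    -- every message and the average over messages is trivial.
    have hw : ∀ w : Fin M, ∑ i, c i *
        (P.instr r (P.slotState N (controlledState φ (t, i)) w t s)).trace.re = S.detect t s r := by
      intro w
      simp only [hout, Matrix.trace_kronecker, (isDensity_single _).2, mul_one]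
      rw [Fintype.sum_prod_type]
      simp only [hc, mul_assoc, ← Finset.mul_sum]
      exact sum_prodDist_mul S.q_dist.2
        (fun x => ∑ z, S.p z * (S.F t z x s r).trace.re) w
    simp only [hw]
    have : (M : ℝ) ≠ 0 := by exact_mod_cast hM.ne'
    simp [this]

/-- The average over codebooks is performed by the protocol itself, so the random coding bound holds
for each message and the detection error is unchanged. -/
theorem infoRegion_subset_unreliableRegion {a b : ℝ} (hψ : IsDensity ψ)
    (hφ : IsDensity (onRight A (depolarizing B a b) ψ)) (hN : ∀ s, IsChannel (N s))
    {θ : Fin 2 → ℝ} (hθ : IsDist θ) (π : Fin 2 → ℝ) :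
    infoRegion N (onRight A (depolarizing B a b) ψ) θ π ⊆ unreliableRegion N θ π a b := by
  classical
  intro x hx ε hε
  -- Half of ε goes to the loss of mutual information; the other half keeps the coding rate strictly
  -- below it.
  obtain ⟨X, Y, Z, Q, _, _, _, _, _, T, S, hT, -, hI, hd⟩ := hx (ε / 2) (half_pos hε)
  have hT' : (0 : ℝ) < T := by exact_mod_cast hT
  obtain ⟨n, M, hn, hM, hrate, g, hg⟩ := exists_random_code S.q_dist (S.law_isDist θ hN hφ hθ)
    (c := T * (x.1 - ε)) (by nlinarith) hε
  let S' := S.repeated (K := Fin n) (finProdFinEquiv.symm : Fin (n * T) ≃ Fin n × Fin T)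
  have hlaw : S'.law θ = prodLaw (Fin n) (S.law θ) := S.repeated_law θ _ hN hφ hθ
  obtain ⟨P, hP, hdec, hdet⟩ := S'.exists_protocol (Nat.mul_pos hn hT) hψ rfl hφ hN hθ hM g
  have : Nonempty (Fin M) := ⟨⟨0, hM⟩⟩
  have : Nonempty (Fin (n * T)) := ⟨⟨0, Nat.mul_pos hn hT⟩⟩
  refine ⟨A, B, _, _, _, _, _, _, _, _, _, _, M, n * T, P, hM, Nat.mul_pos hn hT, hP, ?_, ciSup_le fun w => ?_, ciSup_le fun t => ?_⟩
  · rw [le_div_iff₀ (by exact_mod_cast Nat.mul_pos hn hT)]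
    push_cast
    linarith
  · refine le_trans (le_of_eq ?_) (hg w)
    simp only [hdec, hlaw]
    rw [Finset.sum_comm]
    refine Finset.sum_congr rfl fun C _ => ?_
    rw [← Finset.mul_sum, Finset.sum_comm]
    refine congrArg (fun u : ℝ => prodDist (Fin M) S'.q C * u) ?_
    refine Finset.sum_congr rfl fun y _ => ?_
    simp [Finset.sum_ite_eq]
  · have h := hd (finProdFinEquiv.symm t).2
    simp only [hdet, S', Scheme.repeated_detect]
    exact h

end Coding

/-! ### Unentangled protocols as schemes -/

section Unentangled

variable {I J A B A' B' Q X : Type} [Fintype I] [DecidableEq I] [Fintype J] [DecidableEq J]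
  [Fintype A] [DecidableEq A] [Fintype B] [DecidableEq B] [Fintype A'] [DecidableEq A']
  [Fintype B'] [DecidableEq B'] [Fintype Q] [DecidableEq Q]

/-- The channel that prepares `σ`. -/
def prepareMap (σ : Matrix I I ℂ) : Matrix A A ℂ →ₗ[ℂ] Matrix I I ℂ :=
  ∑ a, submatrixMap (fun i => ((), i)) ∘ₗ appendMap σ ∘ₗ submatrixMap fun _ : Unit => a

/-- The partial trace over the second factor. -/
def traceRight : Matrix (J × B) (J × B) ℂ →ₗ[ℂ] Matrix J J ℂ :=
  ∑ b, submatrixMap fun j => (j, b)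

lemma prepareMap_apply (σ : Matrix I I ℂ) (X : Matrix A A ℂ) : prepareMap σ X = X.trace • σ := by
  ext i i'
  simp [prepareMap, Matrix.sum_apply, Matrix.trace, Finset.sum_mul]

lemma isCP_prepareMap {σ : Matrix I I ℂ} (hσ : σ.PosSemidef) :
    IsCP (prepareMap σ : Matrix A A ℂ →ₗ[ℂ] _) :=
  IsCP.sum _ fun _ _ => (isCP_submatrixMap _).comp ((isCP_appendMap hσ).comp
    (isCP_submatrixMap _))

lemma prepareMap_isChannel {σ : Matrix I I ℂ} (hσ : IsDensity σ) :
    IsChannel (prepareMap σ : Matrix A A ℂ →ₗ[ℂ] _) :=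
  ⟨isCP_prepareMap hσ.1, fun X => by
    rw [prepareMap_apply, Matrix.trace_smul, hσ.2, smul_eq_mul, mul_one]⟩

lemma traceRight_isChannel : IsChannel (traceRight : Matrix (J × B) (J × B) ℂ →ₗ[ℂ] _) :=
  ⟨IsCP.sum _ fun _ _ => isCP_submatrixMap _, fun X => by
    simp only [traceRight, LinearMap.sum_apply, submatrixMap_apply, Matrix.trace_sum]
    simp [Matrix.trace, Fintype.sum_prod_type_right]⟩

lemma appendMap_isChannel {σ : Matrix B B ℂ} (hσ : IsDensity σ) :
    IsChannel (appendMap σ : Matrix I I ℂ →ₗ[ℂ] _) :=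
  ⟨isCP_appendMap hσ.1, fun X => by
    rw [appendMap_apply, Matrix.trace_kronecker, hσ.2, mul_one]⟩

lemma onLeft_kronecker (Φ : Matrix I I ℂ →ₗ[ℂ] Matrix J J ℂ) (X : Matrix I I ℂ)
    (Y : Matrix B B ℂ) : onLeft B Φ (X ⊗ₖ Y) = Φ X ⊗ₖ Y := by
  ext p q
  have : (X ⊗ₖ Y).submatrix (fun i => (i, p.2)) (fun i => (i, q.2)) = Y p.2 q.2 • X := by
    ext i i'
    simp [mul_comm]
  rw [onLeft_apply, this, map_smul, Matrix.smul_apply, smul_eq_mul, Matrix.kroneckerMap_apply,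
    mul_comm]

lemma onLeft_prepareMap (σ : Matrix I I ℂ) (X : Matrix (A × B) (A × B) ℂ) :
    onLeft B (prepareMap σ) X = σ ⊗ₖ Matrix.of fun b b' => ∑ a, X (a, b) (a, b') := by
  ext p q
  rw [onLeft_apply, prepareMap_apply, Matrix.smul_apply, smul_eq_mul, Matrix.kroneckerMap_apply,
    mul_comm]
  rfl

/-- An entangled state is at least as good as a product state. -/
lemma isDevice_of_product {N : Fin 2 → Matrix I I ℂ →ₗ[ℂ] Matrix J J ℂ}
    {φ : Matrix (A × B) (A × B) ℂ} (hφ : IsDensity φ) {σ : Matrix A' A' ℂ} {τ : Matrix B' B' ℂ}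
    (hσ : IsDensity σ) (hτ : IsDensity τ) {enc : X → Matrix A' A' ℂ →ₗ[ℂ] Matrix I I ℂ}
    (henc : ∀ x, IsChannel (enc x)) {instr : Fin 2 → Matrix (J × B') (J × B') ℂ →ₗ[ℂ] Matrix Q Q ℂ}
    (hinstr : IsInstrument instr) :
    IsDevice N φ fun x s r => instr r (onLeft B' (N s) (onLeft B' (enc x) (σ ⊗ₖ τ))) := by
  have hd : ∀ x, IsDensity (enc x σ) := fun x =>
    ⟨(henc x).1.posSemidef hσ.1, by rw [(henc x).2, hσ.2]⟩
  -- The sender ignores its share of φ and prepares the encoded product state; the receiver discards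
  -- its own share and appends τ.
  refine ⟨fun x => prepareMap (enc x σ), fun r => instr r ∘ₗ appendMap τ ∘ₗ traceRight,
    fun x => prepareMap_isChannel (hd x),
    ⟨fun r => (hinstr.1 r).comp ((isCP_appendMap hτ.1).comp traceRight_isChannel.1), fun X => ?_⟩,
    fun x s r => ?_⟩
  · simp only [LinearMap.comp_apply, hinstr.2]
    rw [(appendMap_isChannel hτ).2, traceRight_isChannel.2]
  · beta_reduce
    rw [onLeft_kronecker, onLeft_kronecker, onLeft_prepareMap, onLeft_kronecker,
      LinearMap.comp_apply, LinearMap.comp_apply, appendMap_apply]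
    congr 2
    ext j j'
    have h := hφ.2
    simp only [Matrix.trace, Matrix.diag_apply, Fintype.sum_prod_type_right] at h
    simp [traceRight, Matrix.sum_apply, ← Finset.mul_sum, h]

lemma Scheme.nonempty {N : Fin 2 → Matrix I I ℂ →ₗ[ℂ] Matrix J J ℂ} {φ : Matrix (A × B) (A × B) ℂ}
    {T : ℕ} {X Y Z Q : Type} [Fintype X] [Fintype Y] [Fintype Z] [Fintype Q] [DecidableEq Q]
    (S : Scheme N φ T X Y Z Q) (hN : ∀ s, IsChannel (N s)) (hφ : IsDensity φ) (hT : 0 < T) :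
    Nonempty Q := by
  have hX : Nonempty X := by
    by_contra h
    rw [not_nonempty_iff] at h
    simpa using S.q_dist.2
  have hZ : Nonempty Z := by
    by_contra h
    rw [not_nonempty_iff] at h
    simpa using S.p_dist.2
  obtain ⟨x⟩ := hX
  obtain ⟨z⟩ := hZ
  by_contra h
  rw [not_nonempty_iff] at h
  have := (S.device ⟨0, hT⟩ z).trace_sum hN hφ x 0
  simp [Matrix.trace] at this

/-- A protocol with a separable initial state is a scheme. -/
lemma Protocol.exists_scheme {N : Fin 2 → Matrix I I ℂ →ₗ[ℂ] Matrix J J ℂ}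
    {φ : Matrix (A × B) (A × B) ℂ} (hφ : IsDensity φ) (hN : ∀ s, IsChannel (N s))
    {θ : Fin 2 → ℝ} (hθ : IsDist θ) {M T : ℕ} (P : Protocol I J A' B' Q M T) (hM : 0 < M)
    (hP : IsSeparable P.ρ) :
    ∃ (m : ℕ) (S : Scheme N φ T (Fin M) (Fin M) (Fin m) (Q × Fin 2)),
      S.q = (fun _ => 1 / (M : ℝ)) ∧ S.law θ = P.decodeProb N θ ∧
        ∀ t s r, S.detect t s r = P.detectProb N θ t s r := by
  obtain ⟨m, c, ρA, ρB, hc, hc1, hA, hB, hρ⟩ := hP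
  have hM' : (M : ℝ) ≠ 0 := by exact_mod_cast hM.ne'
  let g : (Fin T → Q × Fin 2) ≃ (Fin T → Fin 2) × (Fin T → Q) :=
    (Equiv.arrowProdEquivProdArrow (Fin T) (fun _ => Q) fun _ => Fin 2).trans (Equiv.prodComm _ _)
  let S : Scheme N φ T (Fin M) (Fin M) (Fin m) (Q × Fin 2) :=
    { q := fun _ => 1 / (M : ℝ)
      q_dist := ⟨fun _ => by positivity, by simp [hM']⟩
      p := c
      p_dist := ⟨hc, hc1⟩
      -- A scheme's block measurement acts on the residual systems alone, so the detection result is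
      -- recorded next to Q. The index z of the separable mixture acts as common randomness.
      F := fun t z w s r => (appendMap (Matrix.single r r 1) ∘ₗ P.instr r)
        (onLeft B' (N s) (onLeft B' (P.enc t w) (ρA z t ⊗ₖ ρB z t)))
      device := fun t z => isDevice_of_product hφ (hA z t) (hB z t) (P.enc_channel t)
        ⟨fun r => (isCP_appendMap (isDensity_single r).1).comp (P.instr_instrument.1 r),
          fun X => by
            rw [← P.instr_instrument.2 X, Matrix.trace_sum, Matrix.trace_sum]
            refine Finset.sum_congr rfl fun r _ => ?_
            rw [LinearMap.comp_apply, (appendMap_isChannel (isDensity_single r)).2]⟩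
      povm := fun _ v => (P.dec v).submatrix g g
      povm_povm := fun _ => ⟨fun v => (P.dec_povm.1 v).submatrix _, by
        have := congrArg (fun X => Matrix.submatrix X g g) P.dec_povm.2
        simp only [Matrix.submatrix_one_equiv] at this
        rw [← this]
        ext f f'
        simp [Matrix.sum_apply]⟩ }
  refine ⟨m, S, rfl, ?_, fun t s r => ?_⟩
  · funext w v
    rw [Protocol.decodeProb_eq N θ hρ]
    refine Finset.sum_congr rfl fun z _ => congrArg (fun u : ℂ => c z * u.re) ?_
    have havg : ∀ t, S.avg θ t z w = ∑ r, (∑ s, (θ s : ℂ) •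
        P.instr r (P.slotState N (ρA z t ⊗ₖ ρB z t) w t s)) ⊗ₖ Matrix.single r r 1 := by
      intro t
      simp only [Scheme.avg, Finset.smul_sum]
      rw [Finset.sum_comm]
      refine Finset.sum_congr rfl fun r _ => ?_
      rw [← appendMap_apply, map_sum]
      refine Finset.sum_congr rfl fun s _ => ?_
      rw [map_smul]
      rfl
    simp only [havg]
    rw [prodOp_sum, Finset.mul_sum, Finset.mul_sum, Matrix.trace_sum, Matrix.trace_sum]
    refine Finset.sum_congr rfl fun r _ => ?_
    have h : (prodOp fun t => (∑ s, (θ s : ℂ) •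
        P.instr (r t) (P.slotState N (ρA z t ⊗ₖ ρB z t) w t s)) ⊗ₖ
          Matrix.single (r t) (r t) (1 : ℂ))
        = (Matrix.single r r (1 : ℂ) ⊗ₖ prodOp fun t => ∑ s, (θ s : ℂ) •
          P.instr (r t) (P.slotState N (ρA z t ⊗ₖ ρB z t) w t s)).submatrix g g := by
      rw [prodOp_kronecker, prodOp_single]
      ext f f'
      simp only [Matrix.submatrix_apply, Matrix.kroneckerMap_apply]
      exact mul_comm _ _
    rw [h]
    change ((P.dec v).submatrix g g * _).trace = _
    rw [Matrix.submatrix_mul_equiv, trace_submatrix_equiv]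
  · rw [Protocol.detectProb_eq N θ hρ hN hθ.2 fun i t => (hA i t).prod (hB i t)]
    refine Finset.sum_congr rfl fun w _ => ?_
    refine congrArg (fun u : ℝ => 1 / (M : ℝ) * u) (Finset.sum_congr rfl fun z _ => ?_)
    refine congrArg (fun u : ℂ => c z * u.re) ?_
    exact (appendMap_isChannel (isDensity_single r)).2 _

/-- The Fano bound costs arbitrarily little rate as the error tends to zero, since both 1 - ε and ε
contribute vanishing logarithmic terms. -/
lemma tendsto_fano_loss (R : ℝ) :
    Filter.Tendsto (fun ε : ℝ => (1 - ε) * (R - ε) + Real.logb 2 (1 - ε) + ε * Real.logb 2 ε)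
      (nhdsWithin 0 (Set.Ioi 0)) (nhds R) := by
  have h : ContinuousAt
      (fun ε : ℝ => (1 - ε) * (R - ε) + Real.log (1 - ε) / Real.log 2 + ε * Real.log ε / Real.log 2)
      0 := by
    refine ContinuousAt.add (ContinuousAt.add (by fun_prop) (ContinuousAt.div_const
      (ContinuousAt.log (by fun_prop) (by norm_num)) _))
      (Real.continuous_mul_log.continuousAt.div_const _)
  have h2 := h.tendsto
  simp only [sub_zero, Real.log_one, zero_div, add_zero, one_mul, zero_mul] at h2
  simpa only [Real.logb, mul_div_assoc] using h2.mono_left nhdsWithin_le_nhds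

theorem unentangledRegion_subset_infoRegion {N : Fin 2 → Matrix I I ℂ →ₗ[ℂ] Matrix J J ℂ}
    {φ : Matrix (A × B) (A × B) ℂ} (hφ : IsDensity φ) (hN : ∀ s, IsChannel (N s))
    {θ : Fin 2 → ℝ} (hθ : IsDist θ) (π : Fin 2 → ℝ) :
    unentangledRegion N θ π ⊆ infoRegion N φ θ π := by
  intro x hx ε hε
  obtain ⟨δ, hδ, hδ0, hδ1⟩ := (((tendsto_fano_loss x.1).eventually
    (lt_mem_nhds (show x.1 - ε < x.1 by linarith))).and
    (Ioo_mem_nhdsGT (show (0 : ℝ) < 1 by norm_num))).exists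
  obtain ⟨A', B', Q, _, _, _, _, _, _, M, T, P, hM, hT, hsep, hrate, hcomm, hdet⟩ := hx δ hδ0
  obtain ⟨m, S, hq, hlaw, hdetect⟩ := P.exists_scheme hφ hN hθ hM hsep
  have hdist := S.law_isDist θ hN hφ hθ
  have hT' : (1 : ℝ) ≤ T := by exact_mod_cast hT
  refine ⟨_, _, _, _, inferInstance, inferInstance, inferInstance, inferInstance, inferInstance,
    T, S, hT, S.nonempty hN hφ hT, ?_, fun t => ?_⟩
  · have hcorrect : ∀ w, 1 - δ ≤ S.law θ w w := by
      intro w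
      have h1 := (le_ciSup (f := fun w : Fin M => ∑ v ∈ Finset.univ.erase w, P.decodeProb N θ w v)
        (Set.finite_range _).bddAbove w).trans hcomm
      have h2 := (hdist w).2
      rw [← Finset.add_sum_erase _ _ (Finset.mem_univ w), hlaw] at h2
      rw [hlaw]
      linarith
    have hf := fano hM hdist hδ0 hδ1 hcorrect
    rw [hq]
    refine le_trans ?_ hf
    rw [le_div_iff₀ (by linarith)] at hrate
    have h1 := mul_le_mul_of_nonneg_left hrate (show 0 ≤ 1 - δ by linarith)
    -- The two logarithmic terms are nonpositive, so T ≥ 1 copies of them are at most one copy;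
    -- hence a δ chosen without knowledge of T suffices.
    have h2 : Real.logb 2 (1 - δ) ≤ 0 :=
      Real.logb_nonpos one_lt_two (by linarith) (by linarith)
    have h3 : δ * Real.logb 2 δ ≤ 0 :=
      mul_nonpos_of_nonneg_of_nonpos hδ0.le (Real.logb_nonpos one_lt_two hδ0.le hδ1.le)
    have h4 := mul_le_mul_of_nonneg_left hδ.le (show (0 : ℝ) ≤ T by linarith)
    nlinarith
  · have h1 := (le_ciSup (f := fun t : Fin T => π 0 * P.detectProb N θ t 0 1 +
      π 1 * P.detectProb N θ t 1 0) (Set.finite_range _).bddAbove t).trans hdet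
    simpa only [Scheme.detectErr, hdetect] using h1

end Unentangled

/-! ### Schemes from a complete measurement in a single slot -/

section ClassicalScheme

variable {I J A B X Y L : Type} [Fintype I] [DecidableEq I] [Fintype J] [DecidableEq J]
  [Fintype A] [DecidableEq A] [Fintype B] [DecidableEq B] [Fintype X] [Fintype Y] [DecidableEq Y]
  [Fintype L] [DecidableEq L]

/-- Measure the vectors `u y`, and keep the outcome in case that its label is `r`. -/
def vectorInstr (u : Y → L → ℂ) (g : Y → Fin 2) (r : Fin 2) :
    Matrix L L ℂ →ₗ[ℂ] Matrix Y Y ℂ :=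
  ∑ y, if g y = r then conjMap (Matrix.vecMulVec (Pi.single y 1) (star (u y))) else 0

/-- The outcome probability of the vector `u` in the state `X`. -/
def overlap (u : L → ℂ) (X : Matrix L L ℂ) : ℂ := star u ⬝ᵥ X *ᵥ u

lemma conjMap_vecMulVec (u : L → ℂ) (y : Y) (X : Matrix L L ℂ) :
    conjMap (Matrix.vecMulVec (Pi.single y 1) (star u)) X = overlap u X • Matrix.single y y 1 := by
  rw [conjMap_apply, Matrix.conjTranspose_vecMulVec, star_star, Matrix.vecMulVec_mul,
    Matrix.vecMulVec_mul_vecMulVec, overlap, Matrix.dotProduct_mulVec]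
  ext i j
  simp [Matrix.vecMulVec_apply, Matrix.single_apply, Pi.single_apply, ← ite_and, eq_comm, and_comm]

lemma vectorInstr_apply (u : Y → L → ℂ) (g : Y → Fin 2) (r : Fin 2) (X : Matrix L L ℂ) :
    vectorInstr u g r X = ∑ y, if g y = r then overlap (u y) X • Matrix.single y y 1 else 0 := by
  simp only [vectorInstr, LinearMap.sum_apply]
  refine Finset.sum_congr rfl fun y _ => ?_
  split_ifs
  · exact conjMap_vecMulVec _ _ _
  · rfl

lemma overlap_eq_trace (u : L → ℂ) (X : Matrix L L ℂ) :
    overlap u X = (Matrix.vecMulVec u (star u) * X).trace := by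
  rw [Matrix.vecMulVec_mul, Matrix.trace_vecMulVec, overlap, Matrix.dotProduct_mulVec,
    dotProduct_comm]

lemma vectorInstr_isInstrument {u : Y → L → ℂ}
    (hu : ∑ y, Matrix.vecMulVec (u y) (star (u y)) = 1) (g : Y → Fin 2) :
    IsInstrument (vectorInstr u g) := by
  refine ⟨fun r => IsCP.sum _ fun y _ => ?_, fun X => ?_⟩
  · split_ifs
    exacts [isCP_conjMap _, IsCP.zero]
  · simp only [vectorInstr_apply]
    rw [Finset.sum_comm]
    simp only [Finset.sum_ite_eq, Finset.mem_univ, if_true, Matrix.trace_sum, Matrix.trace_smul,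
      Matrix.trace_single_eq_same, smul_eq_mul, mul_one, overlap_eq_trace]
    rw [← Matrix.trace_sum, ← Finset.sum_mul, hu, one_mul]

/-- Encoding by `enc`, a complete measurement in every slot, and detection by the maximum a
posteriori rule. -/
lemma exists_classicalScheme {N : Fin 2 → Matrix I I ℂ →ₗ[ℂ] Matrix J J ℂ}
    (φ : Matrix (A × B) (A × B) ℂ) {q : X → ℝ} (hq : IsDist q)
    {enc : X → Matrix A A ℂ →ₗ[ℂ] Matrix I I ℂ} (henc : ∀ x, IsChannel (enc x))
    {u : Y → J × B → ℂ} (hu : ∑ y, Matrix.vecMulVec (u y) (star (u y)) = 1)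
    {W : Fin 2 → X → Y → ℝ}
    (hW : ∀ s x y, overlap (u y) (onLeft B (N s) (onLeft B (enc x) φ)) = W s x y)
    (θ π : Fin 2 → ℝ) :
    ∃ S : Scheme N φ 1 X Y Unit Y, S.q = q ∧ (∀ x y, S.law θ x y = ∑ s, θ s * W s x y) ∧
      ∀ t, S.detectErr π t
        = ∑ y, min (π 0 * ∑ x, q x * W 0 x y) (π 1 * ∑ x, q x * W 1 x y) := by
  -- Each outcome is assigned to the channel state of larger posterior weight, so it contributes the
  -- smaller of the two weights to the error.
  let g : Y → Fin 2 := fun y =>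
    if π 0 * ∑ x, q x * W 0 x y ≤ π 1 * ∑ x, q x * W 1 x y then 1 else 0
  let S : Scheme N φ 1 X Y Unit Y :=
    { q := q
      q_dist := hq
      p := fun _ => 1
      p_dist := ⟨fun _ => zero_le_one, by simp⟩
      F := fun _ _ x s r => vectorInstr u g r (onLeft B (N s) (onLeft B (enc x) φ))
      device := fun _ _ => ⟨enc, vectorInstr u g, henc, vectorInstr_isInstrument hu g,
        fun _ _ _ => rfl⟩
      povm := fun _ y => Matrix.single (fun _ => y) (fun _ => y) 1
      povm_povm := fun _ => ⟨fun y => (isDensity_single _).1, by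
        rw [← sum_single_self (K := Fin 1 → Y), ← (Equiv.funUnique (Fin 1) Y).symm.sum_comp]
        rfl⟩ }
  have hF : ∀ t z x s r, S.F t z x s r
      = ∑ y, if g y = r then (W s x y : ℂ) • Matrix.single y y 1 else 0 := by
    intro t z x s r
    simp only [S, vectorInstr_apply, hW]
  refine ⟨S, rfl, fun x y => ?_, fun t => ?_⟩
  · have havg : ∀ t z, S.avg θ t z x = ∑ y, ((∑ s, θ s * W s x y : ℝ) : ℂ) • Matrix.single y y 1 := by
      intro t z
      have : ∀ s, ∑ r, S.F t z x s r = ∑ y, (W s x y : ℂ) • Matrix.single y y 1 := by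
        intro s
        simp only [hF]
        rw [Finset.sum_comm]
        simp
      simp only [Scheme.avg, this, Finset.smul_sum]
      rw [Finset.sum_comm]
      refine Finset.sum_congr rfl fun y _ => ?_
      simp only [smul_smul, ← Finset.sum_smul, Complex.ofReal_sum, Complex.ofReal_mul]
    have hp : (S.povm () y * prodOp fun t => S.avg θ t () x).trace
        = ((∑ s, θ s * W s x y : ℝ) : ℂ) := by
      rw [show S.povm () y = Matrix.single (fun _ => y) (fun _ => y) 1 from rfl, Matrix.trace_single_mul, one_smul]
      simp only [prodOp, havg, Finset.univ_unique, Finset.prod_singleton, Matrix.sum_apply,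
        Matrix.smul_apply, Matrix.single_apply, smul_eq_mul, and_self, mul_ite, mul_one, mul_zero,
        Finset.sum_ite_eq', Finset.mem_univ, if_true]
    simp only [Scheme.law, Finset.univ_unique, Finset.sum_singleton]
    change 1 * (S.povm () y * prodOp fun t => S.avg θ t () x).trace.re = _
    rw [hp, one_mul, Complex.ofReal_re]
  · have hdet : ∀ s r, S.detect t s r = ∑ y, if g y = r then ∑ x, q x * W s x y else 0 := by
      intro s r
      have htr : ∀ z x, (S.F t z x s r).trace.re = ∑ y, if g y = r then W s x y else 0 := by
        intro z x
        rw [hF, Matrix.trace_sum, Complex.re_sum]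
        refine Finset.sum_congr rfl fun y _ => ?_
        split_ifs <;> simp
      simp only [Scheme.detect, htr, Finset.univ_unique, Finset.sum_singleton]
      change ∑ x, q x * (1 * _) = _
      simp only [one_mul, Finset.mul_sum, mul_ite, mul_zero]
      rw [Finset.sum_comm]
      refine Finset.sum_congr rfl fun y _ => ?_
      split_ifs <;> simp
    rw [Scheme.detectErr, hdet, hdet, Finset.mul_sum, Finset.mul_sum, ← Finset.sum_add_distrib]
    refine Finset.sum_congr rfl fun y _ => ?_
    by_cases h : π 0 * ∑ x, q x * W 0 x y ≤ π 1 * ∑ x, q x * W 1 x y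
    · rw [show g y = 1 from if_pos h, if_pos rfl, if_neg (by decide), min_eq_left h, mul_zero,
        add_zero]
    · rw [show g y = 0 from if_neg h, if_pos rfl, if_neg (by decide),
        min_eq_right (le_of_not_ge h), mul_zero, zero_add]

end ClassicalScheme

/-! ### Weyl operators, Bell basis and the depolarized Bell state -/

section SuperdenseCoding

variable {d : ℕ}

/-- The operators of superdense coding: a cyclic shift by `x.1` after a phase given by `x.2`. -/
def weyl (d : ℕ) [NeZero d] (x : Fin d × Fin d) : Matrix (Fin d) (Fin d) ℂ :=
  Matrix.of fun i j =>
    if i = j + x.1 then Complex.exp (2 * Real.pi * Complex.I / d) ^ (x.2.val * j.val) else 0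

/-- The Bell basis. -/
def bell (d : ℕ) [NeZero d] (x : Fin d × Fin d) : Fin d × Fin d → ℂ :=
  fun p => ((Real.sqrt d)⁻¹ : ℂ) * weyl d x p.1 p.2

variable [NeZero d]

/-- A geometric sum whose ratio is a d-th root of unity, equal to one only for x = y because ω is
primitive. -/
lemma sum_phase (x y : Fin d) :
    ∑ j : Fin d, star (Complex.exp (2 * Real.pi * Complex.I / d) ^ (x.val * j.val)) *
      Complex.exp (2 * Real.pi * Complex.I / d) ^ (y.val * j.val) = if x = y then (d : ℂ) else 0 := by
  have hprim := Complex.isPrimitiveRoot_exp d (NeZero.ne d)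
  set ω := Complex.exp (2 * Real.pi * Complex.I / d) with hω
  have hnorm : star ω * ω = 1 := by
    have h1 : ‖ω‖ = 1 := hprim.norm'_eq_one (NeZero.ne d)
    rw [Complex.star_def, ← Complex.normSq_eq_conj_mul_self, Complex.normSq_eq_norm_sq, h1]
    simp
  have hterm : ∀ j : Fin d, star (ω ^ (x.val * j.val)) * ω ^ (y.val * j.val)
      = (star (ω ^ x.val) * ω ^ y.val) ^ j.val := by
    intro j
    rw [mul_pow, ← star_pow, ← pow_mul, ← pow_mul]
  have hpow : ∀ n : ℕ, star (ω ^ n) * ω ^ n = 1 := by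
    intro n
    rw [star_pow, ← mul_pow, hnorm, one_pow]
  simp only [hterm]
  rw [Fin.sum_univ_eq_sum_range (fun j => (star (ω ^ x.val) * ω ^ y.val) ^ j)]
  split_ifs with h
  · subst h
    simp only [hpow, one_pow]
    simp
  · have hne : star (ω ^ x.val) * ω ^ y.val ≠ 1 := by
      intro h1
      have h2 : ω ^ y.val = ω ^ x.val := by
        calc ω ^ y.val = (star (ω ^ x.val) * ω ^ x.val) * ω ^ y.val := by rw [hpow, one_mul]
          _ = ω ^ x.val * (star (ω ^ x.val) * ω ^ y.val) := by ring
          _ = ω ^ x.val := by rw [h1, mul_one]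
      exact h (Fin.ext (hprim.pow_inj y.isLt x.isLt h2).symm)
    have hd : (star (ω ^ x.val) * ω ^ y.val) ^ d = 1 := by
      rw [mul_pow, ← star_pow, ← pow_mul, ← pow_mul, mul_comm x.val, mul_comm y.val, pow_mul,
        pow_mul, hprim.pow_eq_one]
      simp
    have := geom_sum_mul (star (ω ^ x.val) * ω ^ y.val) d
    rw [hd, sub_self] at this
    exact (mul_eq_zero.1 this).resolve_right (sub_ne_zero.2 hne)

lemma weyl_conjTranspose_mul_self (x : Fin d × Fin d) : (weyl d x)ᴴ * weyl d x = 1 := by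
  have hprim := Complex.isPrimitiveRoot_exp d (NeZero.ne d)
  ext j j'
  simp only [Matrix.mul_apply, Matrix.conjTranspose_apply, weyl, Matrix.of_apply, apply_ite star,
    star_zero, ite_mul, zero_mul]
  rw [Finset.sum_ite_eq' Finset.univ (j + x.1)]
  simp only [Finset.mem_univ, if_true, add_left_inj, Matrix.one_apply, mul_ite, mul_zero]
  refine if_ctx_congr Iff.rfl (fun h => ?_) fun _ => rfl
  subst h
  have h1 := hprim.norm'_eq_one (NeZero.ne d)
  rw [Complex.star_def, ← Complex.normSq_eq_conj_mul_self, Complex.normSq_eq_norm_sq, norm_pow, h1]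
  simp

lemma conjMap_weyl_isChannel (x : Fin d × Fin d) : IsChannel (conjMap (weyl d x)) :=
  ⟨isCP_conjMap _, fun X => by
    rw [conjMap_apply, Matrix.trace_mul_comm, ← Matrix.mul_assoc, weyl_conjTranspose_mul_self,
      one_mul]⟩

/-- Different shifts have disjoint supports; for equal shifts the phases are orthogonal characters.
-/
lemma star_bell_dotProduct (x y : Fin d × Fin d) :
    star (bell d x) ⬝ᵥ bell d y = if x = y then 1 else 0 := by
  have hd : (d : ℂ) ≠ 0 := Nat.cast_ne_zero.2 (NeZero.ne d)
  have hs : (starRingEnd ℂ) ((Real.sqrt d)⁻¹ : ℂ) * ((Real.sqrt d)⁻¹ : ℂ) = (d : ℂ)⁻¹ := by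
    rw [map_inv₀, Complex.conj_ofReal, ← mul_inv, ← Complex.ofReal_mul,
      Real.mul_self_sqrt (Nat.cast_nonneg d), Complex.ofReal_natCast]
  have h : ∀ j, ∑ i, star (weyl d x i j) * weyl d y i j = if x.1 = y.1 then
      star (Complex.exp (2 * Real.pi * Complex.I / d) ^ (x.2.val * j.val)) *
      Complex.exp (2 * Real.pi * Complex.I / d) ^ (y.2.val * j.val) else 0 := by
    intro j
    simp only [weyl, Matrix.of_apply, apply_ite star, star_zero, ite_mul, zero_mul]
    rw [Finset.sum_ite_eq' Finset.univ (j + x.1)]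
    simp only [Finset.mem_univ, if_true, add_right_inj, mul_ite, mul_zero]
  have h2 : star (bell d x) ⬝ᵥ bell d y
      = (d : ℂ)⁻¹ * ∑ j, ∑ i, star (weyl d x i j) * weyl d y i j := by
    simp only [dotProduct, bell, Pi.star_apply, star_mul', Fintype.sum_prod_type_right,
      Finset.mul_sum, ← hs]
    refine Finset.sum_congr rfl fun j _ => Finset.sum_congr rfl fun i _ => ?_
    rw [Complex.star_def]
    ring
  rw [h2]
  simp only [h]
  by_cases h1 : x.1 = y.1
  · simp only [h1, if_true, sum_phase, Prod.ext_iff, true_and]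
    split_ifs
    · exact inv_mul_cancel₀ hd
    · exact mul_zero _
  · simp [h1, Prod.ext_iff]

/-- The square matrix of the Bell vectors has orthonormal columns, and a left inverse of a square
matrix is a right inverse. -/
lemma sum_vecMulVec_bell : ∑ x, Matrix.vecMulVec (bell d x) (star (bell d x)) = 1 := by
  let G : Matrix (Fin d × Fin d) (Fin d × Fin d) ℂ := Matrix.of fun p x => bell d x p
  have h1 : Gᴴ * G = 1 := by
    ext x y
    rw [Matrix.one_apply, ← star_bell_dotProduct]
    rfl
  rw [← mul_eq_one_comm.1 h1]
  ext p p'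
  simp only [Matrix.sum_apply, Matrix.vecMulVec_apply, Matrix.mul_apply,
    Matrix.conjTranspose_apply, G, Matrix.of_apply, Pi.star_apply]

lemma weyl_mulVec_bell (x : Fin d × Fin d) :
    (weyl d x ⊗ₖ (1 : Matrix (Fin d) (Fin d) ℂ)) *ᵥ bell d 0 = bell d x := by
  ext ⟨i, j⟩
  simp only [Matrix.mulVec, dotProduct, Fintype.sum_prod_type, Matrix.kroneckerMap_apply, bell,
    Matrix.one_apply, mul_ite, mul_one, mul_zero, ite_mul, zero_mul, Finset.sum_ite_eq,
    Finset.mem_univ, if_true]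
  have : ∀ k, weyl d 0 k j = if k = j then 1 else 0 := by
    intro k
    simp [weyl]
  simp only [this, mul_ite, mul_one, mul_zero, Finset.sum_ite_eq', Finset.mem_univ, if_true]
  ring

/-- The maximally entangled state that is shifted by `weyl d x`. -/
def bellState (d : ℕ) [NeZero d] (x : Fin d × Fin d) : Matrix (Fin d × Fin d) (Fin d × Fin d) ℂ :=
  Matrix.vecMulVec (bell d x) (star (bell d x))

lemma bellState_isDensity (x : Fin d × Fin d) : IsDensity (bellState d x) :=
  ⟨Matrix.posSemidef_vecMulVec_self_star _, by
    rw [bellState, Matrix.trace_vecMulVec, dotProduct_comm, star_bell_dotProduct, if_pos rfl]⟩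

lemma onLeft_conjMap_bellState (x : Fin d × Fin d) :
    onLeft (Fin d) (conjMap (weyl d x)) (bellState d 0) = bellState d x := by
  rw [onLeft_conjMap, bellState, Matrix.mul_vecMulVec, Matrix.vecMulVec_mul,
    ← Matrix.star_mulVec, weyl_mulVec_bell]
  rfl

lemma overlap_bellState (x y : Fin d × Fin d) :
    overlap (bell d y) (bellState d x) = if x = y then 1 else 0 := by
  rw [overlap, bellState, Matrix.vecMulVec_mulVec, star_bell_dotProduct]
  rw [dotProduct_smul, star_bell_dotProduct]
  by_cases h : x = y
  · simp [h]
  · simp [h, Ne.symm h]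

lemma sum_bell_left (b b' : Fin d) :
    ∑ i, bellState d 0 (b, i) (b', i) = if b = b' then (d : ℂ)⁻¹ else 0 := by
  have hs : ((Real.sqrt d)⁻¹ : ℂ) * ((Real.sqrt d)⁻¹ : ℂ) = (d : ℂ)⁻¹ := by
    rw [← mul_inv, ← Complex.ofReal_mul, Real.mul_self_sqrt (Nat.cast_nonneg d),
      Complex.ofReal_natCast]
  simp only [bellState, Matrix.vecMulVec_apply, bell, Pi.star_apply, weyl, Matrix.of_apply]
  by_cases h : b = b'
  · subst h
    simp [hs, apply_ite]
  · simp [h, apply_ite]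

/-- The maximally entangled state after depolarization. -/
def noisyBell (d : ℕ) [NeZero d] (a b : ℝ) : Matrix (Fin d × Fin d) (Fin d × Fin d) ℂ :=
  onRight (Fin d) (depolarizing (Fin d) a b) (bellState d 0)

/-- The sender's half of a maximally entangled pair is maximally mixed, so replacing the other half
by noise makes the whole pair maximally mixed. This is why dimension d² appears in the region. -/
lemma noisyBell_eq (a b : ℝ) :
    noisyBell d a b = (a : ℂ) • bellState d 0 + ((b : ℂ) / (d : ℂ) ^ 2) • 1 := by
  ext ⟨i, j⟩ ⟨i', j'⟩
  rw [noisyBell, onRight_apply]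
  simp only [depolarizing, LinearMap.coe_mk, AddHom.coe_mk, Matrix.add_apply, Matrix.smul_apply,
    Matrix.submatrix_apply, smul_eq_mul, Fintype.card_fin, Matrix.trace, Matrix.diag_apply,
    sum_bell_left, Matrix.one_apply, Prod.mk.injEq, ite_and]
  congr 1
  split_ifs <;> ring

lemma noisyBell_isDensity {a b : ℝ} (ha : 0 ≤ a) (hb : 0 ≤ b) (hab : a + b = 1) :
    IsDensity (noisyBell d a b) := by
  have hd : (d : ℂ) ≠ 0 := Nat.cast_ne_zero.2 (NeZero.ne d)
  rw [noisyBell_eq]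
  refine ⟨((bellState_isDensity 0).1.smul (by exact_mod_cast ha)).add
    (Matrix.PosSemidef.one.smul ?_), ?_⟩
  · have : (0 : ℝ) ≤ b / (d : ℝ) ^ 2 := by positivity
    exact_mod_cast this
  · rw [Matrix.trace_add, Matrix.trace_smul, Matrix.trace_smul, (bellState_isDensity 0).2,
      Matrix.trace_one]
    simp only [smul_eq_mul, mul_one, Fintype.card_prod, Fintype.card_fin, Nat.cast_mul]
    rw [← Complex.ofReal_one, ← hab]
    field_simp
    push_cast
    ring

/-- Unitary encoding moves the Bell vector and leaves the white noise invariant. -/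
lemma onLeft_conjMap_noisyBell (a b : ℝ) (x : Fin d × Fin d) :
    onLeft (Fin d) (conjMap (weyl d x)) (noisyBell d a b)
      = (a : ℂ) • bellState d x + ((b : ℂ) / (d : ℂ) ^ 2) • 1 := by
  rw [noisyBell_eq, map_add, map_smul, map_smul, onLeft_conjMap_bellState,
    ← Matrix.one_kronecker_one, onLeft_kronecker, conjMap_apply, mul_one,
    mul_eq_one_comm.1 (weyl_conjTranspose_mul_self x)]

end SuperdenseCoding

/-! ### Superdense coding through the identity-depolarizing-erasure channel -/

section Erasure

variable {d : ℕ}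

lemma ideChannel_inl_inl (a b g : ℝ) (X : Matrix (Fin d) (Fin d) ℂ) (i i' : Fin d) :
    ideChannel d a b g X (Sum.inl i) (Sum.inl i')
      = a * X i i' + b / d * X.trace * if i = i' then 1 else 0 := by
  change depolarizing (Fin d) a b X i i' = _
  simp [depolarizing, Matrix.one_apply]

lemma ideChannel_inl_inr (a b g : ℝ) (X : Matrix (Fin d) (Fin d) ℂ) (i : Fin d) (u : Unit) :
    ideChannel d a b g X (Sum.inl i) (Sum.inr u) = 0 := rfl

lemma ideChannel_inr_inl (a b g : ℝ) (X : Matrix (Fin d) (Fin d) ℂ) (i : Fin d) (u : Unit) :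
    ideChannel d a b g X (Sum.inr u) (Sum.inl i) = 0 := rfl

lemma ideChannel_inr_inr (a b g : ℝ) (X : Matrix (Fin d) (Fin d) ℂ) (u v : Unit) :
    ideChannel d a b g X (Sum.inr u) (Sum.inr v) = g * X.trace := rfl

/-- A scaled isometric embedding plus the preparation of a fixed diagonal operator; complete
positivity is visible in this form. -/
lemma ideChannel_eq (a b g : ℝ) :
    ideChannel d a b g = (a : ℂ) • conjMap (Matrix.of fun i j => if i = Sum.inl j then 1 else 0) +
      prepareMap (Matrix.diagonal (Sum.elim (fun _ => (b : ℂ) / d) fun _ => (g : ℂ))) := by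
  refine LinearMap.ext fun X => ?_
  rw [LinearMap.add_apply, prepareMap_apply]
  ext i j
  rcases i with i | i <;> rcases j with j | j <;>
    simp [ideChannel_inl_inl, ideChannel_inl_inr, ideChannel_inr_inl, ideChannel_inr_inr,
      Matrix.mul_apply, Matrix.diagonal_apply, apply_ite, mul_comm]
  by_cases h : i = j <;> simp [h]

lemma ideChannel_isChannel (hd : 0 < d) {a b g : ℝ} (ha : 0 ≤ a) (hb : 0 ≤ b) (hg : 0 ≤ g)
    (h : a + b + g = 1) : IsChannel (ideChannel d a b g) := by
  have hd' : (d : ℂ) ≠ 0 := Nat.cast_ne_zero.2 hd.ne'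
  constructor
  · rw [ideChannel_eq]
    refine ((isCP_conjMap _).smul ha).add (isCP_prepareMap (Matrix.posSemidef_diagonal_iff.2 ?_))
    rintro (i | i)
    · have : 0 ≤ b / d := by positivity
      simp only [Sum.elim_inl]
      exact_mod_cast this
    · simp only [Sum.elim_inr]
      exact_mod_cast hg
  · intro X
    have h1 : (a : ℂ) + b + g = 1 := by exact_mod_cast h
    have h2 : (ideChannel d a b g X).trace = a * X.trace + b * X.trace + g * X.trace := by
      rw [Matrix.trace, Fintype.sum_sum_type]
      simp only [Matrix.diag_apply, ideChannel_inl_inl, ideChannel_inr_inr, if_true, mul_one,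
        Finset.sum_add_distrib, ← Finset.mul_sum, Finset.sum_const, Finset.card_univ,
        Fintype.card_fin, nsmul_eq_mul, Fintype.card_unit, one_smul]
      rw [show ∑ i, X i i = X.trace from rfl]
      field_simp
    rw [h2]
    linear_combination X.trace * h1

variable [NeZero d]

/-- The Bell basis together with the basis of the receiver's share in case of an erasure. -/
def erasureBell (d : ℕ) [NeZero d] :
    (Fin d × Fin d) ⊕ Fin d → (Fin d ⊕ Unit) × Fin d → ℂ :=
  Sum.elim (fun x p => Sum.elim (fun i => bell d x (i, p.2)) (fun _ => 0) p.1)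
    fun b => Pi.single (Sum.inr (), b) 1

lemma sum_vecMulVec_erasureBell :
    ∑ y, Matrix.vecMulVec (erasureBell d y) (star (erasureBell d y)) = 1 := by
  ext ⟨i, b⟩ ⟨i', b'⟩
  simp only [Matrix.sum_apply, Fintype.sum_sum_type, Matrix.vecMulVec_apply, Pi.star_apply,
    erasureBell, Sum.elim_inl, Sum.elim_inr]
  rcases i with i | i <;> rcases i' with i' | i'
  · have h := congrFun (congrFun (sum_vecMulVec_bell (d := d)) (i, b)) (i', b')
    simp only [Matrix.sum_apply, Matrix.vecMulVec_apply, Pi.star_apply] at h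
    simp only [Complex.star_def] at h
    simp [h, Matrix.one_apply]
  · simp
  · simp
  · simp [Matrix.one_apply, Pi.single_apply, apply_ite]

lemma overlap_erasureBell_inl (y : Fin d × Fin d)
    (Z : Matrix ((Fin d ⊕ Unit) × Fin d) ((Fin d ⊕ Unit) × Fin d) ℂ) :
    overlap (erasureBell d (Sum.inl y)) Z
      = overlap (bell d y) (Z.submatrix (Prod.map Sum.inl id) (Prod.map Sum.inl id)) := by
  simp [overlap, dotProduct, Matrix.mulVec, erasureBell, Fintype.sum_prod_type]

lemma overlap_erasureBell_inr (b : Fin d)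
    (Z : Matrix ((Fin d ⊕ Unit) × Fin d) ((Fin d ⊕ Unit) × Fin d) ℂ) :
    overlap (erasureBell d (Sum.inr b)) Z = Z (Sum.inr (), b) (Sum.inr (), b) := by
  simp [overlap, erasureBell]

lemma sum_bellState_left (x : Fin d × Fin d) (b b' : Fin d) :
    ∑ i, bellState d x (i, b) (i, b') = if b = b' then (d : ℂ)⁻¹ else 0 := by
  have hs : ((Real.sqrt d)⁻¹ : ℂ) * ((Real.sqrt d)⁻¹ : ℂ) = (d : ℂ)⁻¹ := by
    rw [← mul_inv, ← Complex.ofReal_mul, Real.mul_self_sqrt (Nat.cast_nonneg d),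
      Complex.ofReal_natCast]
  have h := congrFun (congrFun (weyl_conjTranspose_mul_self x) b') b
  rw [Matrix.mul_apply, Matrix.one_apply] at h
  have h2 : ∑ i, bellState d x (i, b) (i, b')
      = (d : ℂ)⁻¹ * ∑ i, (weyl d x)ᴴ b' i * weyl d x i b := by
    rw [Finset.mul_sum, ← hs]
    refine Finset.sum_congr rfl fun i _ => ?_
    simp only [bellState, Matrix.vecMulVec_apply, bell, Pi.star_apply, star_mul',
      Matrix.conjTranspose_apply, Complex.star_def, map_inv₀, Complex.conj_ofReal]
    ring
  rw [h2, h]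
  simp [eq_comm]

/-- The classical channel that results from superdense coding. -/
def sdcLaw (d : ℕ) (α β γ : ℝ) (x : Fin d × Fin d) : (Fin d × Fin d) ⊕ Fin d → ℝ :=
  Sum.elim (fun y => (if x = y then α else 0) + β / (d : ℝ) ^ 2) fun _ => γ / d

/-- The noise of the resource, scaled by α, and the noise of the channel are both white on the pair,
because the receiver's share is maximally mixed; they add up to α b + β. After an erasure that share
is all that is left, so the d outcomes are uniform for every letter. -/
lemma overlap_sdc {a b : ℝ} (hab : a + b = 1) (α β γ : ℝ) (x : Fin d × Fin d)
    (y : (Fin d × Fin d) ⊕ Fin d) :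
    overlap (erasureBell d y) (onLeft (Fin d) (ideChannel d α β γ)
      (onLeft (Fin d) (conjMap (weyl d x)) (noisyBell d a b)))
      = sdcLaw d (α * a) (α * b + β) γ x y := by
  have hd : (d : ℂ) ≠ 0 := Nat.cast_ne_zero.2 (NeZero.ne d)
  have hab' : (a : ℂ) + b = 1 := by exact_mod_cast hab
  rw [onLeft_conjMap_noisyBell]
  set Y := (a : ℂ) • bellState d x + ((b : ℂ) / (d : ℂ) ^ 2) • 1 with hY
  have htr : ∀ c c', (Y.submatrix (fun i => (i, c)) fun i => (i, c')).trace
      = if c = c' then (d : ℂ)⁻¹ else 0 := by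
    intro c c'
    simp only [Matrix.trace, Matrix.diag_apply, Matrix.submatrix_apply, hY, Matrix.add_apply,
      Matrix.smul_apply, smul_eq_mul, Finset.sum_add_distrib, ← Finset.mul_sum, sum_bellState_left,
      Matrix.one_apply, Prod.mk.injEq, true_and]
    split_ifs
    · simp only [Finset.sum_const, Finset.card_univ, Fintype.card_fin, nsmul_eq_mul, mul_one]
      field_simp
      exact hab'
    · simp
  rcases y with y | c
  · rw [overlap_erasureBell_inl]
    have : ((onLeft (Fin d) (ideChannel d α β γ) Y).submatrix (Prod.map Sum.inl id)
        (Prod.map Sum.inl id)) = (α * a : ℂ) • bellState d x +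
          ((α * b + β : ℂ) / (d : ℂ) ^ 2) • 1 := by
      ext ⟨i, c⟩ ⟨i', c'⟩
      rw [Matrix.submatrix_apply, onLeft_apply]
      simp only [Prod.map, id, ideChannel_inl_inl, htr, Matrix.submatrix_apply]
      simp only [hY, Matrix.add_apply, Matrix.smul_apply, smul_eq_mul, Matrix.one_apply,
        Prod.mk.injEq, ite_and]
      split_ifs <;> ring
    rw [this]
    have hadd : ∀ (c c' : ℂ) (X X' : Matrix (Fin d × Fin d) (Fin d × Fin d) ℂ),
        overlap (bell d y) (c • X + c' • X')
          = c * overlap (bell d y) X + c' * overlap (bell d y) X' := by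
      intro c c' X X'
      simp only [overlap, Matrix.add_mulVec, Matrix.smul_mulVec, dotProduct_add, dotProduct_smul,
        smul_eq_mul]
    rw [hadd, overlap_bellState, show overlap (bell d y) 1 = 1 by
      rw [overlap, Matrix.one_mulVec, star_bell_dotProduct, if_pos rfl]]
    simp only [sdcLaw, Sum.elim_inl]
    push_cast
    split_ifs <;> simp
  · rw [overlap_erasureBell_inr, onLeft_apply]
    simp only [ideChannel_inr_inr, htr, if_true, sdcLaw, Sum.elim_inr]
    push_cast
    rfl

end Erasure

/-! ### The explicit region -/

section Region

lemma sum_sdc_inl {d : ℕ} (f : ℝ → ℝ) (s : Finset (Fin d × Fin d)) (p₁ p₂ : ℝ) :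
    ∑ x, f (if x ∈ s then p₁ else p₂) = s.card * f p₁ + ((d ^ 2 : ℕ) - (s.card : ℝ)) * f p₂ := by
  have h : ∀ x, f (if x ∈ s then p₁ else p₂) = f p₂ + if x ∈ s then f p₁ - f p₂ else 0 := by
    intro x
    split_ifs <;> ring
  simp only [h, Finset.sum_add_distrib, Finset.sum_ite_mem, Finset.univ_inter, Finset.sum_const,
    Finset.card_univ, Fintype.card_prod, Fintype.card_fin, nsmul_eq_mul]
  push_cast
  ring

theorem regionOne_subset_infoRegion {d : ℕ} [NeZero d] {α β γ θ : Fin 2 → ℝ} (π : Fin 2 → ℝ)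
    {a b : ℝ} (hα : ∀ s, 0 ≤ α s) (hβ : ∀ s, 0 ≤ β s) (hγ : ∀ s, 0 ≤ γ s)
    (hsum : ∀ s, α s + β s + γ s = 1) (hθ : IsDist θ) (ha : 0 ≤ a) (hb : 0 ≤ b) (hab : a + b = 1) :
    regionOne (d ^ 2) (fun s => α s * a) (fun s => α s * b + β s) γ θ π ⊆
      infoRegion (fun s => ideChannel d (α s) (β s) (γ s)) (noisyBell d a b) θ π := by
  have hd0 : 0 < d := Nat.pos_of_ne_zero (NeZero.ne d)
  have hd : (d : ℝ) ≠ 0 := Nat.cast_ne_zero.2 hd0.ne'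
  have hN : ∀ s, IsChannel (ideChannel d (α s) (β s) (γ s)) := fun s =>
    ideChannel_isChannel hd0 (hα s) (hβ s) (hγ s) (hsum s)
  have hφ := noisyBell_isDensity (d := d) ha hb hab
  refine convexHull_min ?_ (infoRegion_convex π hN hφ hθ)
  rintro ⟨R, Pe⟩ ⟨n, p₁, p₂, hn1, hnD, hp₁, hp₂, hnp, hR, hPe⟩ ε hε
  -- The law is symmetric under relabelling the d² letters, so any n of them may receive the
  -- probability p₁.
  obtain ⟨s, -, hs⟩ := Finset.exists_subset_card_eq (s := (Finset.univ : Finset (Fin d × Fin d)))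
    (n := n) (by simpa [sq] using hnD)
  set q : Fin d × Fin d → ℝ := fun x => if x ∈ s then p₁ else p₂ with hq
  have hqdist : IsDist q := by
    refine ⟨fun x => ?_, ?_⟩
    · simp only [hq]
      split_ifs
      exacts [hp₁.1, hp₂.1]
    · rw [hq, sum_sdc_inl (fun p => p), hs]
      exact hnp
  obtain ⟨S, hSq, hlaw, hdet⟩ := exists_classicalScheme
    (N := fun s => ideChannel d (α s) (β s) (γ s)) (noisyBell d a b) hqdist
    (fun x => conjMap_weyl_isChannel x) sum_vecMulVec_erasureBell
    (W := fun s => sdcLaw d (α s * a) (α s * b + β s) (γ s))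
    (fun s x y => overlap_sdc hab (α s) (β s) (γ s) x y) θ π
  have hout : ∀ A B C y, ∑ x, q x * sdcLaw d A B C x y
      = Sum.elim (fun y => A * q y + B / (d : ℝ) ^ 2) (fun _ => C / d) y := by
    rintro A B C (y | y)
    · simp only [sdcLaw, Sum.elim_inl, mul_add, Finset.sum_add_distrib, mul_ite, mul_zero,
        Finset.sum_ite_eq', Finset.mem_univ, if_true, ← Finset.sum_mul, hqdist.2, one_mul]
      ring
    · simp only [sdcLaw, Sum.elim_inr, ← Finset.sum_mul, hqdist.2, one_mul]
  refine ⟨_, _, _, _, inferInstance, inferInstance, inferInstance, inferInstance, inferInstance,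
    1, S, one_pos, S.nonempty hN hφ one_pos, ?_, fun t => ?_⟩
  · have hlaw' : S.law θ = sdcLaw d (θ 0 * (α 0 * a) + θ 1 * (α 1 * a))
        (θ 0 * (α 0 * b + β 0) + θ 1 * (α 1 * b + β 1)) (θ 0 * γ 0 + θ 1 * γ 1) := by
      funext x y
      rw [hlaw, Fin.sum_univ_two]
      rcases y with y | y
      · simp only [sdcLaw, Sum.elim_inl]
        split_ifs <;> ring
      · simp only [sdcLaw, Sum.elim_inr]
        ring
    have hdist := S.law_isDist θ hN hφ hθ
    set A := θ 0 * (α 0 * a) + θ 1 * (α 1 * a) with hA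
    set B := θ 0 * (α 0 * b + β 0) + θ 1 * (α 1 * b + β 1) with hB
    set C := θ 0 * γ 0 + θ 1 * γ 1 with hC
    rw [mutualInfo_eq_xlog S.q_dist hdist, hSq, hlaw']
    have h1 : ∀ x, ∑ y, xlog (sdcLaw d A B C x y)
        = xlog (A + B / (d : ℝ) ^ 2) + ((d : ℝ) ^ 2 - 1) * xlog (B / (d : ℝ) ^ 2)
          + d * xlog (C / d) := by
      intro x
      have h2 : ∀ y : Fin d × Fin d, xlog ((if x = y then A else 0) + B / (d : ℝ) ^ 2)
          = xlog (B / (d : ℝ) ^ 2) +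
            if x = y then xlog (A + B / (d : ℝ) ^ 2) - xlog (B / (d : ℝ) ^ 2) else 0 := by
        intro y
        split_ifs
        · ring
        · simp
      rw [Fintype.sum_sum_type]
      simp only [sdcLaw, Sum.elim_inl, Sum.elim_inr, h2, Finset.sum_add_distrib, Finset.sum_ite_eq,
        Finset.mem_univ, if_true, Finset.sum_const, Finset.card_univ, Fintype.card_prod,
        Fintype.card_fin, nsmul_eq_mul]
      push_cast
      ring
    -- The erasure outcomes contribute the same term here and in `h1`, so they cancel from the
    -- mutual information.
    have h3 : ∑ y, xlog (outDist q (sdcLaw d A B C) y)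
        = n * xlog (p₁ * A + B / (d : ℝ) ^ 2) +
          ((d : ℝ) ^ 2 - n) * xlog (p₂ * A + B / (d : ℝ) ^ 2) + d * xlog (C / d) := by
      simp only [outDist, hout, Fintype.sum_sum_type, Sum.elim_inl, Sum.elim_inr, Finset.sum_const,
        Finset.card_univ, Fintype.card_fin, nsmul_eq_mul]
      simp only [hq]
      rw [sum_sdc_inl (fun p => xlog (A * p + B / (d : ℝ) ^ 2)), hs]
      push_cast
      simp only [mul_comm A]
    simp only [h1, h3, ← Finset.sum_mul, hqdist.2, one_mul]
    push_cast at hR ⊢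
    linarith
  · rw [hdet]
    refine le_trans (le_of_eq ?_) hPe
    simp only [hout, Fintype.sum_sum_type, Sum.elim_inl, Sum.elim_inr, Finset.sum_const,
      Finset.card_univ, Fintype.card_fin, nsmul_eq_mul]
    simp only [hq]
    rw [sum_sdc_inl (fun p => min (π 0 * (α 0 * a * p + (α 0 * b + β 0) / (d : ℝ) ^ 2))
      (π 1 * (α 1 * a * p + (α 1 * b + β 1) / (d : ℝ) ^ 2))), hs]
    -- The d erasure outcomes have probability γ / d each and together give the single erasure term
    -- of the detection error.
    have hmin : (d : ℝ) * min (π 0 * (γ 0 / d)) (π 1 * (γ 1 / d))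
        = min (π 0 * γ 0) (π 1 * γ 1) := by
      rw [mul_min_of_nonneg _ _ (Nat.cast_nonneg d)]
      congr 1 <;> field_simp
    have he : ∀ (s : Fin 2) (p : ℝ), π s * (α s * a * p + (α s * b + β s) / (d : ℝ) ^ 2)
        = π s * (α s * a) * p + π s * (α s * b + β s) / ((d ^ 2 : ℕ) : ℝ) := by
      intro s p
      push_cast
      ring
    rw [hmin]
    simp only [he]

end Region

end JCID
end

theorem theorem5 (d : ℕ) (hd : 0 < d) (α β γ θ π : Fin 2 → ℝ) (a b : ℝ)
    (hα : ∀ s, 0 ≤ α s) (hβ : ∀ s, 0 ≤ β s) (hγ : ∀ s, 0 ≤ γ s) (hsum : ∀ s, α s + β s + γ s = 1)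
    (hθ : ∀ s, 0 ≤ θ s) (hθsum : θ 0 + θ 1 = 1) (hπ : ∀ s, 0 < π s) (hπsum : π 0 + π 1 = 1)
    (ha : 0 ≤ a) (hb : 0 ≤ b) (hab : a + b = 1) :
    convexHull ℝ
        (JCID.regionOne (d ^ 2) (fun s => α s * a) (fun s => α s * b + β s) γ θ π ∪
          JCID.unentangledRegion (fun s => JCID.ideChannel d (α s) (β s) (γ s)) θ π) ⊆
      JCID.unreliableRegion (fun s => JCID.ideChannel d (α s) (β s) (γ s)) θ π a b := by
  have : NeZero d := ⟨hd.ne'⟩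
  have hθ' : JCID.IsDist θ := ⟨hθ, by rw [Fin.sum_univ_two, hθsum]⟩
  have hN : ∀ s, JCID.IsChannel (JCID.ideChannel d (α s) (β s) (γ s)) := fun s =>
    JCID.ideChannel_isChannel hd (hα s) (hβ s) (hγ s) (hsum s)
  have hφ := JCID.noisyBell_isDensity (d := d) ha hb hab
  exact (convexHull_min (Set.union_subset
    (JCID.regionOne_subset_infoRegion π hα hβ hγ hsum hθ' ha hb hab)
    (JCID.unentangledRegion_subset_infoRegion hφ hN hθ' π))
    (JCID.infoRegion_convex π hN hφ hθ')).trans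
    (JCID.infoRegion_subset_unreliableRegion (JCID.bellState_isDensity 0) hφ hN hθ' π)
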